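/- Let $N\ge 1$, let $D\subset\mathbb R^N$ be compact, let $m>0$, and let $$C_m(D)=\{\Omega\subset D:\ \Omega \text{ open and convex},\ |\Omega|=m\},$$ where $|\Omega|$ is the Lebesgue measure. A sequence $(\Omega_n)\subset C_m(D)$ converges uniformly to $\Omega\in C_m(D)$ if for every $\varepsilon>0$ one has, for all $n$ large enough, $\Omega_n\subset\Omega+B(\varepsilon)$ and $\Omega\subset\Omega_n+B(\varepsilon)$, where $B(\varepsilon)$ is the open ball of radius $\varepsilon$ centred at the origin (this is convergence in the Hausdorff distance). Let $a_{ij}=a_{ji}:D\to\mathbb R$ $(1\le i,j\le N)$ be continuous and uniformly elliptic: there is $\nu>0$ with $\nu|\xi|^2\le\sum_{i,j}a_{ij}(x)\xi_i\xi_j$ for all $x\in D$, $\xi\in\mathbb R^N$. For $\Omega\in C_m(D)$, the Dirichlet eigenvalues of $Lu=\partial_i(a_{ij}(x)\partial_j u)$ on $\Omega$ are, with the sign convention that makes the weak form positive, the real numbers $\lambda$ for which there is $u\in H^1_0(\Omega)$, $u\neq0$, with $$\int_\Omega \sum_{i,j}a_{ij}\,\partial_j u\,\partial_i v\,dx=\lambda\int_\Omega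 u\,v\,dx\qquad\text{for all } v\in H^1_0(\Omega),$$ where $H^1_0(\Omega)$ is the closure of $C_c^\infty(\Omega)$ in the $H^1$ norm. Let $\lambda_1(\Omega)\le\lambda_2(\Omega)\le\cdots$ be these eigenvalues in nondecreasing order, counted with multiplicity; that is, $\lambda_k(\Omega)$ is the least $\mu$ such that there are $k$ linearly independent eigenfunctions with eigenvalues at most $\mu$. Then for every integer $k\ge1$ the eigenvalue $\lambda_k(\Omega)$ exists for every $\Omega\in C_m(D)$, and 1. (boundedness) there is $M\in\mathbb R$ such that $\lambda_k(\Omega)\in[-M,M]$ for all $\Omega\in C_m(D)$; 2. (continuity) if $\Omega_n,\Omega\in C_m(D)$ and $\Omega_n\to\Omega$ uniformly, then $\lambda_k(\Omega_n)\to\lambda_k(\Omega)$. -/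

import Mathlib

open MeasureTheory Filter Topology
open scoped ContDiff Pointwise

noncomputable section

/-- The class `C_m(D)` of open convex sets `Ω ⊆ D` with Lebesgue measure `m`. -/
def convexClass {N : ℕ} (D : Set (EuclideanSpace ℝ (Fin N))) (m : ℝ) :
    Set (Set (EuclideanSpace ℝ (Fin N))) :=
  {Ω | Ω ⊆ D ∧ IsOpen Ω ∧ Convex ℝ Ω ∧ volume Ω = ENNReal.ofReal m}

/-- Uniform (Hausdorff) convergence of a sequence of sets: for every `ε > 0`, for `n` large enough,
`Ω_n ⊆ Ω + B(ε)` and `Ω ⊆ Ω_n + B(ε)`, with `B(ε)` the open ball of radius `ε` centred at `0`. -/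
def UniformlyConverges {N : ℕ} (Ωs : ℕ → Set (EuclideanSpace ℝ (Fin N)))
    (Ω : Set (EuclideanSpace ℝ (Fin N))) : Prop :=
  ∀ ε : ℝ, 0 < ε → ∀ᶠ n in atTop,
    Ωs n ⊆ Ω + Metric.ball (0 : EuclideanSpace ℝ (Fin N)) ε ∧
    Ω ⊆ Ωs n + Metric.ball (0 : EuclideanSpace ℝ (Fin N)) ε

/-- Uniform ellipticity of the coefficients `a` on `D`:
`ν |ξ|² ≤ a_ij(x) ξ_i ξ_j` for some `ν > 0`, all `x ∈ D` and all `ξ`. -/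
def UniformlyEllipticOn {N : ℕ} (a : EuclideanSpace ℝ (Fin N) → Matrix (Fin N) (Fin N) ℝ)
    (D : Set (EuclideanSpace ℝ (Fin N))) : Prop :=
  ∃ ν : ℝ, 0 < ν ∧ ∀ x ∈ D, ∀ ξ : EuclideanSpace ℝ (Fin N),
    ν * ‖ξ‖ ^ 2 ≤ ∑ i, ∑ j, a x i j * ξ i * ξ j

/-- The Hilbert space `L²(Ω) × L²(Ω; ℝᴺ)`, with `‖(u, g)‖² = ‖u‖² + ‖g‖²`. A Sobolev function `u`
is represented in it by the pair `(u, ∇u)`, whose norm is the `H¹(Ω)` norm of `u`. -/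
abbrev L2Pair {N : ℕ} (Ω : Set (EuclideanSpace ℝ (Fin N))) : Type :=
  WithLp 2 (Lp ℝ 2 (volume.restrict Ω) × Lp (EuclideanSpace ℝ (Fin N)) 2 (volume.restrict Ω))

/-- The space `C_c^∞(Ω)`, each test function `φ` being represented by the pair `(φ, ∇φ)`. -/
def testPairs {N : ℕ} (Ω : Set (EuclideanSpace ℝ (Fin N))) : Submodule ℝ (L2Pair Ω) where
  carrier := {p | ∃ φ : EuclideanSpace ℝ (Fin N) → ℝ,
    ContDiff ℝ ∞ φ ∧ HasCompactSupport φ ∧ tsupport φ ⊆ Ω ∧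
    p.fst =ᵐ[volume.restrict Ω] φ ∧ p.snd =ᵐ[volume.restrict Ω] gradient φ}
  zero_mem' := by
    refine ⟨0, contDiff_const, HasCompactSupport.zero, by simp [tsupport], ?_, ?_⟩
    · exact Lp.coeFn_zero _ _ _
    · have h : gradient (0 : EuclideanSpace ℝ (Fin N) → ℝ) = 0 := by
        funext x
        simp [gradient]
      rw [h]
      exact Lp.coeFn_zero _ _ _
  add_mem' := by
    rintro p q ⟨φ, hφ, hφc, hφs, hp1, hp2⟩ ⟨ψ, hψ, hψc, hψs, hq1, hq2⟩
    refine ⟨φ + ψ, hφ.add hψ, hφc.add hψc,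
      (tsupport_add φ ψ).trans (Set.union_subset hφs hψs), ?_, ?_⟩
    · exact (Lp.coeFn_add p.fst q.fst).trans (hp1.add hq1)
    · have h : gradient (φ + ψ) = gradient φ + gradient ψ := by
        funext x
        simp only [gradient, Pi.add_apply]
        rw [fderiv_add (hφ.differentiable (by simp) x) (hψ.differentiable (by simp) x), map_add]
      rw [h]
      exact (Lp.coeFn_add p.snd q.snd).trans (hp2.add hq2)
  smul_mem' := by
    rintro c p ⟨φ, hφ, hφc, hφs, hp1, hp2⟩
    refine ⟨c • φ, hφ.const_smul c, hφc.smul_left (f := fun _ => c),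
      (tsupport_smul_subset_right (fun _ => c) φ).trans hφs, ?_, ?_⟩
    · exact (Lp.coeFn_smul c p.fst).trans (hp1.const_smul c)
    · have h : gradient (c • φ) = c • gradient φ := by
        funext x
        simp only [gradient, Pi.smul_apply]
        rw [fderiv_const_smul (hφ.differentiable (by simp) x), map_smul]
      rw [h]
      exact (Lp.coeFn_smul c p.snd).trans (hp2.const_smul c)

/-- The Sobolev space `H¹₀(Ω)`: the closure of `C_c^∞(Ω)` in the `H¹` norm. An element is the pair
`(u, ∇u)` of a function and its weak gradient, both limits in `L²` of test functions and
of their gradients. -/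
def H10 {N : ℕ} (Ω : Set (EuclideanSpace ℝ (Fin N))) : Submodule ℝ (L2Pair Ω) :=
  (testPairs Ω).topologicalClosure

/-- The weak form of the operator: `∫_Ω a_ij(x) ∂_j u ∂_i v dx`. -/
def weakForm {N : ℕ} (a : EuclideanSpace ℝ (Fin N) → Matrix (Fin N) (Fin N) ℝ)
    (Ω : Set (EuclideanSpace ℝ (Fin N))) (u v : H10 Ω) : ℝ :=
  ∫ x in Ω, ∑ i, ∑ j, a x i j * u.1.snd x j * v.1.snd x i

/-- `u ∈ H¹₀(Ω)` is an eigenfunction for the eigenvalue `σ`: `u ≠ 0` and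
`∫_Ω a_ij ∂_j u ∂_i v dx = σ ∫_Ω u v dx` for all `v ∈ H¹₀(Ω)`. -/
def IsEigenfunction {N : ℕ} (a : EuclideanSpace ℝ (Fin N) → Matrix (Fin N) (Fin N) ℝ)
    (Ω : Set (EuclideanSpace ℝ (Fin N))) (σ : ℝ) (u : H10 Ω) : Prop :=
  u ≠ 0 ∧ ∀ v : H10 Ω, weakForm a Ω u v = σ * ∫ x in Ω, u.1.fst x * v.1.fst x

/-- The set of real numbers `μ` such that there are at least `k` eigenvalues `≤ μ`, counted with
multiplicity, i.e. `k` linearly independent eigenfunctions whose eigenvalues are `≤ μ`. -/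
def eigenvalueBounds {N : ℕ} (a : EuclideanSpace ℝ (Fin N) → Matrix (Fin N) (Fin N) ℝ)
    (Ω : Set (EuclideanSpace ℝ (Fin N))) (k : ℕ) : Set ℝ :=
  {μ | ∃ (u : Fin k → H10 Ω) (σ : Fin k → ℝ), LinearIndependent ℝ u ∧
    ∀ i, IsEigenfunction a Ω (σ i) (u i) ∧ σ i ≤ μ}

/-- The `k`-th Dirichlet eigenvalue `λ_k(Ω)` (`k = 1, 2, …`), in nondecreasing order and counted
with multiplicity: the least `μ` such that at least `k` eigenvalues are `≤ μ`. -/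
def dirichletEigenvalue {N : ℕ} (a : EuclideanSpace ℝ (Fin N) → Matrix (Fin N) (Fin N) ℝ)
    (k : ℕ) (Ω : Set (EuclideanSpace ℝ (Fin N))) : ℝ :=
  sInf (eigenvalueBounds a Ω k)

end

/-! The eigenvalue `λ_k` obeys the Courant–Fischer principle: it is the least `μ` for which some
`k`-dimensional subspace of `H¹₀(Ω)` has all Rayleigh quotients at most `μ`. Eigenvalues on
different domains can therefore be compared through linear maps between the Sobolev spaces. If `x ↦
c + t x` sends `Ω` into `Ω'`, composition with its inverse multiplies `∫ u²` by `t ^ N` and the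
energy by at most `t ^ N * t⁻² * C`, where `C` bounds the ratio of the coefficient forms at
corresponding points. Hence `λ_k(Ω') ≤ t⁻² C λ_k(Ω)`, which is
`dirichletEigenvalue_le_of_homothety`.

Boundedness: eigenvalues are nonnegative, and by compactness of convex bodies all sets of the class
contain a ball of one fixed radius (`exists_forall_ball_subset`). Translating that ball into `Ω`
bounds `λ_k(Ω)` by a constant times the Laplace eigenvalue of the ball.

Continuity: if `Ω_n → Ω`, a fixed ball about some `x₀ ∈ Ω` lies in every late `Ω_n`, by convexity. A
contraction towards `x₀` with ratio near `1` then maps `Ω` into `Ω_n` and `Ω_n` into `Ω`. It moves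
points little, so by uniform continuity and ellipticity the forms change by a factor near `1`, and
each eigenvalue is at most a factor near `1` times the other.

Existence and Courant–Fischer are proved for an abstract pair (energy, mass): the direct method
minimizes the Rayleigh quotient, and successive orthogonal complements give the higher eigenvalues.
The compactness this needs is Rellich's theorem, stated as an inequality and obtained from
Poincaré's inequality on the cells of a fine grid. -/

noncomputable section

/-! ### Variational theory of an abstract pair of forms -/

section Abstract

variable {V : Type*} [NormedAddCommGroup V] [NormedSpace ℝ V]

/-- A pair of symmetric nonnegative bounded forms `E`, `b` on a Banach space `V`, such that `E + b`
is coercive, `b` is compact with respect to the norm, and `b` has infinite rank. -/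
structure IsSpectralPair (E b : V →L[ℝ] V →L[ℝ] ℝ) : Prop where
  symm_energy : ∀ u v, E u v = E v u
  symm_mass : ∀ u v, b u v = b v u
  energy_nonneg : ∀ u, 0 ≤ E u u
  mass_nonneg : ∀ u, 0 ≤ b u u
  coercive : ∃ c : ℝ, 0 < c ∧ ∀ u, c * ‖u‖ ^ 2 ≤ E u u + b u u
  compact : ∀ ε : ℝ, 0 < ε → ∃ (n : ℕ) (l : Fin n → V →L[ℝ] ℝ),
    ∀ u, b u u ≤ ∑ i, l i u ^ 2 + ε * ‖u‖ ^ 2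
  infinite : ∀ n : ℕ, ∃ v : Fin n → V, ∀ c : Fin n → ℝ, c ≠ 0 →
    0 < b (∑ i, c i • v i) (∑ i, c i • v i)

namespace IsSpectralPair

variable {E b : V →L[ℝ] V →L[ℝ] ℝ}

/-- The finitely many functionals in `compact` are bounded along the sequence, so they converge
along the ultrafilter and their differences become small. The rest of the mass is controlled by the
norm bound. Using one ultrafilter for every `δ` replaces a diagonal extraction of subsequences. -/
lemma exists_ultrafilter_mass_sub_le (h : IsSpectralPair E b) {v : ℕ → V} {B : ℝ}
    (hv : ∀ n, ‖v n‖ ≤ B) (𝒰 : Ultrafilter ℕ) {δ : ℝ} (hδ : 0 < δ) :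
    ∃ S ∈ 𝒰, ∀ n ∈ S, ∀ m ∈ S, b (v n - v m) (v n - v m) ≤ δ := by
  have hB : 0 ≤ B := (norm_nonneg _).trans (hv 0)
  -- Since `‖v p - v q‖ ≤ 2 * B`, this costs at most `δ / 2`; the other half is shared among the `n`
  -- functionals through `η` below. The added `1`s keep the denominators positive when `B = 0` or `n
  -- = 0`.
  obtain ⟨n, l, hl⟩ := h.compact (δ / (2 * (4 * B ^ 2 + 1))) (by positivity)
  have hlim : ∀ i, ∃ y, Tendsto (fun k => l i (v k)) 𝒰 (𝓝 y) := by
    intro i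
    have hc : IsCompact (Metric.closedBall (0 : ℝ) (‖l i‖ * B)) := isCompact_closedBall _ _
    obtain ⟨y, -, hy⟩ := hc.ultrafilter_le_nhds (𝒰.map fun k => l i (v k)) (by
      rw [le_principal_iff]
      refine Ultrafilter.mem_map.2 (Filter.mem_of_superset Filter.univ_mem fun k _ => ?_)
      refine mem_closedBall_zero_iff.2 (((l i).le_opNorm _).trans ?_)
      gcongr
      exact hv k)
    exact ⟨y, hy⟩
  choose y hy using hlim
  set η : ℝ := δ / (2 * (n + 1)) with hη
  have hηpos : 0 < η := by positivity
  have hnear : ∀ i, ∀ᶠ k in (𝒰 : Filter ℕ), |l i (v k) - y i| < √η / 2 := by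
    intro i
    have := Metric.tendsto_nhds.1 (hy i) (√η / 2) (by positivity)
    simpa [Real.dist_eq] using this
  refine ⟨{k | ∀ i, |l i (v k) - y i| < √η / 2}, (eventually_all.2 hnear), ?_⟩
  intro p hp q hq
  have h1 : ∀ i, l i (v p - v q) ^ 2 ≤ η := by
    intro i
    have ha := abs_lt.1 (hp i)
    have hb := abs_lt.1 (hq i)
    rw [map_sub]
    have : |l i (v p) - l i (v q)| ≤ √η := by
      rw [abs_le]; constructor <;> linarith [ha.1, ha.2, hb.1, hb.2]
    calc _ = |l i (v p) - l i (v q)| ^ 2 := (sq_abs _).symm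
      _ ≤ √η ^ 2 := by gcongr
      _ = η := Real.sq_sqrt hηpos.le
  have h2 : ‖v p - v q‖ ^ 2 ≤ 4 * B ^ 2 + 1 := by
    have : ‖v p - v q‖ ≤ 2 * B := (norm_sub_le _ _).trans (by linarith [hv p, hv q])
    nlinarith [norm_nonneg (v p - v q)]
  calc _ ≤ ∑ i, l i (v p - v q) ^ 2 + δ / (2 * (4 * B ^ 2 + 1)) * ‖v p - v q‖ ^ 2 := hl _
    _ ≤ ∑ _i : Fin n, η + δ / (2 * (4 * B ^ 2 + 1)) * (4 * B ^ 2 + 1) := by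
        gcongr with i _
        exact h1 i
    _ = n * η + δ / 2 := by
        simp only [Finset.sum_const, Finset.card_univ, Fintype.card_fin, nsmul_eq_mul]
        congr 1
        field_simp
    _ ≤ δ := by
        have : (n : ℝ) * η ≤ δ / 2 := by
          rw [hη, mul_div_assoc', div_le_div_iff₀ (by positivity) (by positivity)]
          nlinarith
        linarith

/-- The Rayleigh quotient attains its minimum on every closed subspace on which `b ≠ 0`. -/
theorem exists_minimizer [CompleteSpace V] (h : IsSpectralPair E b) (M : Submodule ℝ V)
    (hM : IsClosed (M : Set V)) (hne : ∃ v ∈ M, 0 < b v v) :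
    ∃ v ∈ M, b v v = 1 ∧ ∀ w ∈ M, E v v * b w w ≤ E w w := by
  set S : Set ℝ := {s | ∃ v ∈ M, b v v = 1 ∧ E v v = s} with hS
  have hnorm : ∀ w ∈ M, 0 < b w w → E w w / b w w ∈ S := by
    intro w hw hpos
    refine ⟨(√(b w w))⁻¹ • w, M.smul_mem _ hw, ?_, ?_⟩
    · have := Real.mul_self_sqrt hpos.le
      simp only [map_smul, smul_apply, smul_eq_mul]
      rw [← mul_assoc, ← mul_inv, this, inv_mul_cancel₀ hpos.ne']
    · have := Real.mul_self_sqrt hpos.le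
      simp only [map_smul, smul_apply, smul_eq_mul]
      rw [← mul_assoc, ← mul_inv, this, inv_mul_eq_div]
  have hSne : S.Nonempty := by
    obtain ⟨v, hv, hpos⟩ := hne
    exact ⟨_, hnorm v hv hpos⟩
  have hSb : BddBelow S := ⟨0, by rintro s ⟨v, -, -, rfl⟩; exact h.energy_nonneg v⟩
  set σ := sInf S
  have hσ0 : 0 ≤ σ := le_csInf hSne (by rintro s ⟨v, -, -, rfl⟩; exact h.energy_nonneg v)
  have hσ : ∀ w ∈ M, σ * b w w ≤ E w w := by
    intro w hw
    rcases (h.mass_nonneg w).eq_or_lt with h0 | hpos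
    · rw [← h0, mul_zero]; exact h.energy_nonneg w
    · exact (le_div_iff₀ hpos).1 (csInf_le hSb (hnorm w hw hpos))
  obtain ⟨s, -, hs, hsS⟩ := exists_seq_tendsto_sInf hSne hSb
  choose v hvM hvb hvE using hsS
  obtain ⟨c, hc, hcoer⟩ := h.coercive
  obtain ⟨B₀, hB₀⟩ := hs.bddAbove_range
  have hbound : ∀ n, ‖v n‖ ≤ √((B₀ + 1) / c) := by
    intro n
    apply Real.le_sqrt_of_sq_le
    rw [le_div_iff₀ hc]
    have h1 := hcoer (v n)
    rw [hvE, hvb] at h1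
    have h2 := hB₀ ⟨n, rfl⟩
    linarith
  set 𝒰 : Ultrafilter ℕ := hyperfilter ℕ
  have h𝒰 : (𝒰 : Filter ℕ) ≤ atTop := Nat.hyperfilter_le_atTop
  have hcauchy : Cauchy (map v (𝒰 : Filter ℕ)) := by
    rw [Metric.cauchy_iff]
    refine ⟨inferInstance, fun ε hε => ?_⟩
    -- Parallelogram law: with `b (v p - v q) ≤ δ` the sum `v p + v q` has mass at least `4 - δ`,
    -- hence energy at least `σ * (4 - δ)`. The energies of `v p` and `v q` are below `σ + δ`, so
    -- the difference has energy at most `(4 + σ) * δ`. Adding its mass gives `(5 + σ) * δ`, and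
    -- coercivity turns this into a norm bound.
    set δ : ℝ := c * (ε / 2) ^ 2 / (5 + σ) with hδ
    have hδpos : 0 < δ := by positivity
    obtain ⟨A, hA, hAb⟩ := h.exists_ultrafilter_mass_sub_le hbound 𝒰 hδpos
    have hnear : ∀ᶠ n in (𝒰 : Filter ℕ), s n < σ + δ :=
      (hs.mono_left h𝒰).eventually_lt_const (by linarith)
    refine ⟨v '' (A ∩ {n | s n < σ + δ}), image_mem_map (inter_mem hA hnear), ?_⟩
    rintro _ ⟨p, ⟨hpA, hps⟩, rfl⟩ _ ⟨q, ⟨hqA, hqs⟩, rfl⟩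
    have h1 := hAb p hpA q hqA
    have h2 := hσ (v p + v q) (M.add_mem (hvM p) (hvM q))
    have h3 := hcoer (v p - v q)
    have e1 := hvE p
    have e2 := hvE q
    have e3 := hvb p
    have e4 := hvb q
    have s1 := h.symm_energy (v p) (v q)
    have s2 := h.symm_mass (v p) (v q)
    simp only [Set.mem_ofPred_eq] at hps hqs
    simp only [map_add, map_sub, add_apply, sub_apply]
      at h1 h2 h3
    have h4 : c * ‖v p - v q‖ ^ 2 ≤ (5 + σ) * δ := by nlinarith
    have h5 : (5 + σ) * δ = c * (ε / 2) ^ 2 := by rw [hδ]; field_simp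
    rw [dist_eq_norm]
    have h6 : ‖v p - v q‖ ^ 2 ≤ (ε / 2) ^ 2 := by
      rw [h5] at h4; exact le_of_mul_le_mul_left h4 hc
    have := abs_le_of_sq_le_sq h6 (by positivity)
    linarith [le_abs_self ‖v p - v q‖]
  obtain ⟨x, hx⟩ := CompleteSpace.complete hcauchy
  have hx : Tendsto v 𝒰 (𝓝 x) := hx
  have hxE : E x x = σ := by
    have h1 : Tendsto (fun n => E (v n) (v n)) 𝒰 (𝓝 (E x x)) :=
      ((by fun_prop : Continuous fun y => E y y).tendsto x).comp hx
    simp only [hvE] at h1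
    exact tendsto_nhds_unique h1 (hs.mono_left h𝒰)
  refine ⟨x, hM.mem_of_tendsto hx (Eventually.of_forall hvM), ?_, ?_⟩
  · have h1 : Tendsto (fun n => b (v n) (v n)) 𝒰 (𝓝 (b x x)) :=
      ((by fun_prop : Continuous fun y => b y y).tendsto x).comp hx
    simp only [hvb] at h1
    exact tendsto_nhds_unique h1 tendsto_const_nhds
  · rw [hxE]; exact hσ

end IsSpectralPair

/-- `u` is an eigenvector of the pair `(E, b)` with eigenvalue `σ`. -/
def IsPairEigenvector (E b : V →L[ℝ] V →L[ℝ] ℝ) (σ : ℝ) (u : V) : Prop :=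
  u ≠ 0 ∧ ∀ v, E u v = σ * b u v

/-- The `μ` that bound `k` eigenvalues of the pair `(E, b)`, counted with multiplicity. -/
def pairEigenvalueBounds (E b : V →L[ℝ] V →L[ℝ] ℝ) (k : ℕ) : Set ℝ :=
  {μ | ∃ (u : Fin k → V) (σ : Fin k → ℝ), LinearIndependent ℝ u ∧
    ∀ i, IsPairEigenvector E b (σ i) (u i) ∧ σ i ≤ μ}

/-- The `μ` that bound the Rayleigh quotient on some `k`-dimensional subspace. -/
def rayleighBounds (E b : V →L[ℝ] V →L[ℝ] ℝ) (k : ℕ) : Set ℝ :=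
  {μ | ∃ u : Fin k → V, LinearIndependent ℝ u ∧ ∀ c : Fin k → ℝ,
    E (∑ i, c i • u i) (∑ i, c i • u i) ≤ μ * b (∑ i, c i • u i) (∑ i, c i • u i)}

namespace IsSpectralPair

variable {E b : V →L[ℝ] V →L[ℝ] ℝ}

/-- With no mass, the energy bound leaves no energy either, and coercivity applies. Thus a Rayleigh
bound excludes nonzero vectors of zero mass, although `b` is only assumed nonnegative. -/
lemma eq_zero_of_energy_le (h : IsSpectralPair E b) {u : V} {μ : ℝ} (hE : E u u ≤ μ * b u u)
    (hb : b u u ≤ 0) : u = 0 := by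
  have hb0 : b u u = 0 := le_antisymm hb (h.mass_nonneg u)
  obtain ⟨c, hc, hcoer⟩ := h.coercive
  have h1 := hcoer u
  rw [hb0] at hE h1
  have h2 : ‖u‖ ^ 2 ≤ 0 := by
    have : c * ‖u‖ ^ 2 ≤ c * 0 := by linarith
    exact le_of_mul_le_mul_left this hc
  exact norm_eq_zero.1 (pow_eq_zero_iff (two_ne_zero) |>.1 (le_antisymm h2 (by positivity)))

lemma mass_eq_zero_of_ne (h : IsSpectralPair E b) {u v : V} {σ τ : ℝ}
    (hu : ∀ w, E u w = σ * b u w) (hv : ∀ w, E v w = τ * b v w) (hne : σ ≠ τ) : b u v = 0 := by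
  have h1 := hu v
  have h2 := hv u
  rw [h.symm_energy, h2, h.symm_mass v u] at h1
  have : (σ - τ) * b u v = 0 := by linarith
  exact (mul_eq_zero.1 this).resolve_left (sub_ne_zero.2 hne)

/-- The given eigenvectors need not be orthogonal within an eigenspace. Instead of orthonormalizing
them, `μ * b - E` on their span is written as the mass of the combination with coefficients rescaled
by `√(μ - σ i)`, hence is nonnegative. -/
lemma pairEigenvalueBounds_subset (h : IsSpectralPair E b) (k : ℕ) :
    pairEigenvalueBounds E b k ⊆ rayleighBounds E b k := by
  rintro μ ⟨u, σ, hu, hσ⟩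
  refine ⟨u, hu, fun c => ?_⟩
  have h0 := h.mass_nonneg (∑ i, (√(μ - σ i) * c i) • u i)
  -- Either the two eigenvalues agree and the roots multiply, or the eigenvectors are `b`-orthogonal
  -- and both sides vanish.
  have key : ∀ i j, √(μ - σ i) * √(μ - σ j) * b (u i) (u j) = (μ - σ i) * b (u i) (u j) := by
    intro i j
    by_cases hij : σ i = σ j
    · rw [← hij, Real.mul_self_sqrt (by linarith [(hσ i).2])]
    · rw [h.mass_eq_zero_of_ne (hσ i).1.2 (hσ j).1.2 hij]; simp
  have e : b (∑ i, (√(μ - σ i) * c i) • u i) (∑ i, (√(μ - σ i) * c i) • u i) =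
      μ * b (∑ i, c i • u i) (∑ i, c i • u i) - E (∑ i, c i • u i) (∑ i, c i • u i) := by
    simp only [map_sum, map_smul, sum_apply, smul_apply,
      smul_eq_mul, Finset.mul_sum, ← Finset.sum_sub_distrib]
    refine Finset.sum_congr rfl fun i _ => Finset.sum_congr rfl fun j _ => ?_
    have k1 := key j i
    rw [(hσ j).1.2]
    linear_combination c i * c j * k1
  linarith

/-- Dimension count: `k` linear conditions on `k + 1` coefficients have a nonzero solution. -/
lemma exists_mem_span_orthogonal (b : V →L[ℝ] V →L[ℝ] ℝ) {k : ℕ} (w : Fin (k + 1) → V)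
    (u : Fin k → V) :
    ∃ c : Fin (k + 1) → ℝ, c ≠ 0 ∧ ∀ i, b (u i) (∑ j, c j • w j) = 0 := by
  let L : (Fin (k + 1) → ℝ) →ₗ[ℝ] (Fin k → ℝ) :=
    LinearMap.pi fun i => (b (u i)).toLinearMap ∘ₗ Fintype.linearCombination ℝ w
  have hker : LinearMap.ker L ≠ ⊥ := LinearMap.ker_ne_bot_of_finrank_lt (by simp)
  obtain ⟨c, hc, hc0⟩ := Submodule.exists_mem_ne_zero_of_ne_bot hker
  refine ⟨c, hc0, fun i => ?_⟩
  have := congrFun (LinearMap.mem_ker.1 hc) i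
  simpa [L, Fintype.linearCombination_apply] using this

/-- The vectors that are `b`-orthogonal to all the `u i`. -/
def orthogonalTo (b : V →L[ℝ] V →L[ℝ] ℝ) {k : ℕ} (u : Fin k → V) : Submodule ℝ V :=
  ⨅ i, LinearMap.ker (b (u i)).toLinearMap

lemma mem_orthogonalTo {k : ℕ} {u : Fin k → V} {v : V} :
    v ∈ orthogonalTo b u ↔ ∀ i, b (u i) v = 0 := by
  simp [orthogonalTo]

lemma isClosed_orthogonalTo {k : ℕ} (u : Fin k → V) :
    IsClosed (orthogonalTo b u : Set V) := by
  have : (orthogonalTo b u : Set V) = ⋂ i, {v | b (u i) v = 0} := by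
    ext v; simp [mem_orthogonalTo]
  rw [this]
  exact isClosed_iInter fun i => isClosed_eq (b (u i)).continuous continuous_const

/-- A minimizer of the Rayleigh quotient on the complement of orthonormal eigenvectors is an
eigenvector. -/
lemma eigenvector_of_minimizer (h : IsSpectralPair E b) {k : ℕ} {u : Fin k → V} {σ : Fin k → ℝ}
    (hu : ∀ i j, b (u i) (u j) = if i = j then 1 else 0)
    (hσ : ∀ i v, E (u i) v = σ i * b (u i) v) {v : V} (hv : v ∈ orthogonalTo b u)
    (hb : b v v = 1) (hmin : ∀ w ∈ orthogonalTo b u, E v v * b w w ≤ E w w) (w : V) :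
    E v w = E v v * b v w := by
  have hv' := mem_orthogonalTo.1 hv
  have key : ∀ w ∈ orthogonalTo b u, E v w = E v v * b v w := by
    intro w hw
    -- First variation along `v + s • w`: a nonnegative quadratic in `s` without constant term has
    -- no linear term, as its discriminant shows.
    have hq : ∀ s : ℝ, 0 ≤ (E w w - E v v * b w w) * (s * s) +
        (2 * (E v w - E v v * b v w)) * s + 0 := by
      intro s
      have h1 := hmin (v + s • w) (Submodule.add_mem _ hv (Submodule.smul_mem _ s hw))
      simp only [map_add, map_smul, add_apply, smul_apply,
        smul_eq_mul, hb] at h1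
      rw [h.symm_energy w v, h.symm_mass w v] at h1
      linarith
    have hd := discrim_le_zero hq
    rw [discrim] at hd
    nlinarith [sq_nonneg (E v w - E v v * b v w)]
  -- A general `w` is reduced to its component orthogonal to the `u i`; the removed part contributes
  -- nothing, since `v` is orthogonal to each `u i` for both `b` and `E`.
  have hp : w - ∑ i, b (u i) w • u i ∈ orthogonalTo b u := by
    rw [mem_orthogonalTo]
    intro i
    simp [hu]
  have h1 := key _ hp
  have h2 : ∀ i, b v (u i) = 0 := fun i => by rw [h.symm_mass]; exact hv' i
  have h3 : ∀ i, E v (u i) = 0 := fun i => by rw [h.symm_energy, hσ, hv', mul_zero]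
  simpa [h2, h3] using h1

/-- The last conjunct records the ordering: each `u i` minimized the quotient on a larger
complement, so its eigenvalue is at most that of any later minimizer. -/
lemma exists_eigenvectors [CompleteSpace V] (h : IsSpectralPair E b) (k : ℕ) :
    ∃ (u : Fin k → V) (σ : Fin k → ℝ), (∀ i j, b (u i) (u j) = if i = j then 1 else 0) ∧
      (∀ i v, E (u i) v = σ i * b (u i) v) ∧
      ∀ i, ∀ v ∈ orthogonalTo b u, σ i * b v v ≤ E v v := by
  induction k with
  | zero => exact ⟨Fin.elim0, Fin.elim0, fun i => i.elim0, fun i => i.elim0, fun i => i.elim0⟩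
  | succ k ih =>
    obtain ⟨u, σ, hu, hσ, hmin⟩ := ih
    obtain ⟨w, hw⟩ := h.infinite (k + 1)
    obtain ⟨c, hc, hc'⟩ := exists_mem_span_orthogonal b w u
    obtain ⟨v, hvM, hvb, hvmin⟩ := h.exists_minimizer _ (isClosed_orthogonalTo u)
      ⟨_, mem_orthogonalTo.2 hc', hw c hc⟩
    have hv' := mem_orthogonalTo.1 hvM
    have hv'' : ∀ i, b v (u i) = 0 := fun i => by rw [h.symm_mass]; exact hv' i
    have hle : ∀ x, x ∈ orthogonalTo b (Fin.snoc u v : Fin (k + 1) → V) →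
        x ∈ orthogonalTo b u := by
      intro x hx
      rw [mem_orthogonalTo] at hx ⊢
      intro i
      simpa using hx i.castSucc
    refine ⟨Fin.snoc u v, Fin.snoc σ (E v v), ?_, ?_, ?_⟩
    · intro i j
      refine Fin.lastCases ?_ (fun i => ?_) i <;> refine Fin.lastCases ?_ (fun j => ?_) j
      · simp [hvb]
      · simp [hv'', (Fin.castSucc_lt_last j).ne']
      · simp [hv', (Fin.castSucc_lt_last i).ne]
      · simp [hu]
    · intro i x
      refine Fin.lastCases ?_ (fun i => ?_) i
      · simpa using h.eigenvector_of_minimizer hu hσ hvM hvb hvmin x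
      · simpa using hσ i x
    · intro i x hx
      refine Fin.lastCases ?_ (fun i => ?_) i
      · simpa using hvmin x (hle x hx)
      · simpa using hmin i x (hle x hx)

/-- The Courant–Fischer principle: the least bound of `k` eigenvalues exists and is the least
bound of the Rayleigh quotient on `k`-dimensional subspaces. -/
theorem exists_isLeast [CompleteSpace V] (h : IsSpectralPair E b) {k : ℕ} (hk : 1 ≤ k) :
    ∃ τ : ℝ, 0 ≤ τ ∧ IsLeast (pairEigenvalueBounds E b k) τ ∧ IsLeast (rayleighBounds E b k) τ := by
  obtain ⟨k, rfl⟩ : ∃ l, k = l + 1 := ⟨k - 1, by omega⟩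
  obtain ⟨u, σ, hu, hσ, hmin⟩ := h.exists_eigenvectors k
  obtain ⟨w, hw⟩ := h.infinite (k + 1)
  obtain ⟨c, hc, hc'⟩ := exists_mem_span_orthogonal b w u
  obtain ⟨v, hvM, hvb, hvmin⟩ := h.exists_minimizer _ (isClosed_orthogonalTo u)
    ⟨_, mem_orthogonalTo.2 hc', hw c hc⟩
  have hv' := mem_orthogonalTo.1 hvM
  have hv'' : ∀ i, b v (u i) = 0 := fun i => by rw [h.symm_mass]; exact hv' i
  have hon : ∀ i j : Fin (k + 1), b ((Fin.snoc u v : Fin (k + 1) → V) i)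
      ((Fin.snoc u v : Fin (k + 1) → V) j) = if i = j then 1 else 0 := by
    intro i j
    refine Fin.lastCases ?_ (fun i => ?_) i <;> refine Fin.lastCases ?_ (fun j => ?_) j
    · simp [hvb]
    · simp [hv'', (Fin.castSucc_lt_last j).ne']
    · simp [hv', (Fin.castSucc_lt_last i).ne]
    · simp [hu]
  have hmem : E v v ∈ pairEigenvalueBounds E b (k + 1) := by
    refine ⟨Fin.snoc u v, Fin.snoc σ (E v v), ?_, ?_⟩
    · rw [Fintype.linearIndependent_iff]
      intro g hg i
      have h1 := congrArg (b ((Fin.snoc u v : Fin (k + 1) → V) i)) hg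
      simpa [map_sum, hon] using h1
    · intro i
      refine ⟨⟨fun h0 => ?_, fun x => ?_⟩, ?_⟩
      · have := hon i i
        rw [h0] at this
        simp at this
      · refine Fin.lastCases ?_ (fun i => ?_) i
        · simpa using h.eigenvector_of_minimizer hu hσ hvM hvb hvmin x
        · simpa using hσ i x
      · refine Fin.lastCases ?_ (fun i => ?_) i
        · simp
        · simpa [hvb] using hmin i v hvM
  -- Any subspace of dimension `k + 1` meets the complement of the `k` eigenvectors, where the
  -- Rayleigh quotient is at least `E v v`.
  have hlow : ∀ μ ∈ rayleighBounds E b (k + 1), E v v ≤ μ := by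
    rintro μ ⟨x, hx, hxμ⟩
    obtain ⟨d, hd, hd'⟩ := exists_mem_span_orthogonal b x u
    have h1 := hxμ d
    have h2 := hvmin _ (mem_orthogonalTo.2 hd')
    have hne : ∑ j, d j • x j ≠ 0 := fun h0 =>
      hd (funext fun i => Fintype.linearIndependent_iff.1 hx d h0 i)
    have hpos : 0 < b (∑ j, d j • x j) (∑ j, d j • x j) := by
      by_contra hcon
      exact hne (h.eq_zero_of_energy_le h1 (not_lt.1 hcon))
    exact le_of_mul_le_mul_right (h2.trans h1) hpos
  exact ⟨E v v, h.energy_nonneg v, ⟨hmem, fun μ hμ => hlow μ (h.pairEigenvalueBounds_subset _ hμ)⟩,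
    ⟨h.pairEigenvalueBounds_subset _ hmem, hlow⟩⟩

/-- Comparison of the least Rayleigh bounds of two pairs through a linear map. -/
theorem rayleighBounds_map {V' : Type*} [NormedAddCommGroup V'] [NormedSpace ℝ V']
    {E' b' : V' →L[ℝ] V' →L[ℝ] ℝ} (h : IsSpectralPair E b) (T : V →ₗ[ℝ] V') {p q : ℝ}
    (hp : 0 < p) (hq : 0 ≤ q) (hTb : ∀ u, b' (T u) (T u) = p * b u u)
    (hTE : ∀ u, E' (T u) (T u) ≤ q * E u u) {k : ℕ} {μ : ℝ} (hμ : μ ∈ rayleighBounds E b k) :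
    q / p * μ ∈ rayleighBounds E' b' k := by
  obtain ⟨u, hu, hμ⟩ := hμ
  have hT : ∀ c : Fin k → ℝ, ∑ i, c i • T (u i) = T (∑ i, c i • u i) := by simp
  refine ⟨fun i => T (u i), ?_, fun c => ?_⟩
  · rw [Fintype.linearIndependent_iff]
    intro c hc
    rw [hT] at hc
    have h1 := hTb (∑ i, c i • u i)
    rw [hc] at h1
    -- `T` is not assumed injective: it preserves mass up to the factor `p`, and on this subspace
    -- zero mass forces the vector to vanish.
    have h2 : b (∑ i, c i • u i) (∑ i, c i • u i) = 0 := by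
      simpa [hp.ne'] using h1.symm
    exact Fintype.linearIndependent_iff.1 hu c (h.eq_zero_of_energy_le (hμ c) h2.le)
  · rw [hT, hTb]
    refine (hTE _).trans ((mul_le_mul_of_nonneg_left (hμ c) hq).trans_eq ?_)
    field_simp

end IsSpectralPair

end Abstract

/-! ### Poincaré's inequality on a cubic grid -/

section Rellich

lemma sq_integral_le_integral_sq {α : Type*} [MeasurableSpace α] {μ : Measure α}
    [IsProbabilityMeasure μ] {f : α → ℝ} (hf : MemLp f 2 μ) :
    (∫ x, f x ∂μ) ^ 2 ≤ ∫ x, f x ^ 2 ∂μ := by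
  have h1 : Integrable f μ := hf.integrable one_le_two
  have h2 : Integrable (fun x => f x ^ 2) μ := hf.integrable_sq
  have h0 : 0 ≤ ∫ x, (f x - ∫ y, f y ∂μ) ^ 2 ∂μ := integral_nonneg fun x => sq_nonneg _
  have e : ∫ x, (f x - ∫ y, f y ∂μ) ^ 2 ∂μ = ∫ x, f x ^ 2 ∂μ - (∫ x, f x ∂μ) ^ 2 := by
    have : (fun x => (f x - ∫ y, f y ∂μ) ^ 2) =
        fun x => (f x ^ 2 - (2 * ∫ y, f y ∂μ) * f x) + (∫ y, f y ∂μ) ^ 2 := by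
      funext x; ring
    have h3 : Integrable (fun x => f x ^ 2 - (2 * ∫ y, f y ∂μ) * f x) μ := h2.sub (h1.const_mul _)
    rw [this, integral_add h3 (integrable_const _),
      integral_sub h2 (h1.const_mul _), integral_const_mul]
    simp
    ring
  linarith

/-- Expanding the square expresses the deviation from the mean through differences `f x - f y`,
which translation estimates control. -/
lemma integral_sq_eq_add_integral_sub_sq {α : Type*} [MeasurableSpace α] {μ : Measure α}
    [IsFiniteMeasure μ] {f : α → ℝ} (hf : MemLp f 2 μ) :
    2 * μ.real Set.univ * ∫ x, f x ^ 2 ∂μ =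
      2 * (∫ x, f x ∂μ) ^ 2 + ∫ x, ∫ y, (f x - f y) ^ 2 ∂μ ∂μ := by
  have h1 : Integrable f μ := hf.integrable one_le_two
  have h2 : Integrable (fun x => f x ^ 2) μ := hf.integrable_sq
  have inner : ∀ x, ∫ y, (f x - f y) ^ 2 ∂μ =
      (μ.real Set.univ * f x ^ 2 - (2 * ∫ y, f y ∂μ) * f x) + ∫ y, f y ^ 2 ∂μ := by
    intro x
    have : (fun y => (f x - f y) ^ 2) = fun y => (f x ^ 2 - (2 * f x) * f y) + f y ^ 2 := by
      funext y; ring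
    have h3 : Integrable (fun y => f x ^ 2 - (2 * f x) * f y) μ :=
      (integrable_const _).sub (h1.const_mul _)
    rw [this, integral_add h3 h2,
      integral_sub (integrable_const _) (h1.const_mul _), integral_const_mul]
    simp
    ring
  simp only [inner]
  have h3 : Integrable (fun x => μ.real Set.univ * f x ^ 2 - (2 * ∫ y, f y ∂μ) * f x) μ :=
    (h2.const_mul _).sub (h1.const_mul _)
  rw [integral_add h3 (integrable_const _),
    integral_sub (h2.const_mul _) (h1.const_mul _), integral_const_mul, integral_const_mul]
  simp
  ring

variable {N : ℕ}

local notation "𝔼" => EuclideanSpace ℝ (Fin N)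

lemma continuous_gradient {φ : EuclideanSpace ℝ (Fin N) → ℝ} (hφ : ContDiff ℝ ∞ φ) :
    Continuous (gradient φ) := by
  have : Continuous (fderiv ℝ φ) := hφ.continuous_fderiv (by simp)
  exact (InnerProductSpace.toDual ℝ _).symm.continuous.comp this

/-- Fundamental theorem of calculus along the segment, then Jensen on `(0, 1]` and Cauchy–Schwarz in
the inner product. -/
lemma sq_sub_le_integral_gradient {φ : EuclideanSpace ℝ (Fin N) → ℝ} (hφ : ContDiff ℝ ∞ φ)
    (x z : EuclideanSpace ℝ (Fin N)) :
    (φ (x + z) - φ x) ^ 2 ≤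
      ∫ s in Set.Ioc (0 : ℝ) 1, ‖z‖ ^ 2 * ‖gradient φ (x + s • z)‖ ^ 2 := by
  have hg : Continuous (gradient φ) := continuous_gradient hφ
  set g : ℝ → ℝ := fun s => inner ℝ (gradient φ (x + s • z)) z with hgdef
  have hgc : Continuous g := by fun_prop
  have hd : ∀ s : ℝ, HasDerivAt (fun s : ℝ => φ (x + s • z)) (g s) s := by
    intro s
    have h1 : HasFDerivAt φ (fderiv ℝ φ (x + s • z)) (x + s • z) :=
      (hφ.differentiable (by simp) _).hasFDerivAt
    have h2 : HasDerivAt (fun s : ℝ => x + s • z) z s := by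
      simpa using ((hasDerivAt_id s).smul_const z).const_add x
    have h3 := h1.comp_hasDerivAt s h2
    have e : g s = fderiv ℝ φ (x + s • z) z := by
      simp only [hgdef, gradient, InnerProductSpace.toDual_symm_apply]
    rw [e]
    exact h3
  have hftc : ∫ s in (0 : ℝ)..1, g s = φ (x + z) - φ x := by
    rw [intervalIntegral.integral_eq_sub_of_hasDerivAt (fun s _ => hd s)
      (hgc.intervalIntegrable _ _), one_smul, zero_smul, add_zero]
  rw [intervalIntegral.integral_of_le zero_le_one] at hftc
  rw [← hftc]
  have : IsProbabilityMeasure (volume.restrict (Set.Ioc (0 : ℝ) 1)) := ⟨by simp⟩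
  have hint : ∀ f : ℝ → ℝ, Continuous f → Integrable f (volume.restrict (Set.Ioc (0 : ℝ) 1)) :=
    fun f hf => (hf.integrableOn_Icc (a := 0) (b := 1)).mono_set Set.Ioc_subset_Icc_self
  have hL2 : MemLp g 2 (volume.restrict (Set.Ioc (0 : ℝ) 1)) :=
    (memLp_two_iff_integrable_sq hgc.aestronglyMeasurable).2 (hint _ (by fun_prop))
  refine (sq_integral_le_integral_sq hL2).trans
    (integral_mono (hint _ (by fun_prop)) (hint _ (by fun_prop)) fun s => ?_)
  have h1 : |g s| ≤ ‖gradient φ (x + s • z)‖ * ‖z‖ := abs_real_inner_le_norm _ _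
  calc g s ^ 2 = |g s| ^ 2 := (sq_abs _).symm
    _ ≤ (‖gradient φ (x + s • z)‖ * ‖z‖) ^ 2 := by gcongr
    _ = _ := by ring

lemma lintegral_translation_sub_sq_le {φ : EuclideanSpace ℝ (Fin N) → ℝ} (hφ : ContDiff ℝ ∞ φ)
    (z : EuclideanSpace ℝ (Fin N)) :
    ∫⁻ x, ENNReal.ofReal ((φ (x + z) - φ x) ^ 2) ≤
      ENNReal.ofReal (‖z‖ ^ 2) * ∫⁻ x, ENNReal.ofReal (‖gradient φ x‖ ^ 2) := by
  have hg : Continuous (gradient φ) := continuous_gradient hφ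
  calc ∫⁻ x, ENNReal.ofReal ((φ (x + z) - φ x) ^ 2)
      ≤ ∫⁻ x, ∫⁻ s in Set.Ioc (0 : ℝ) 1,
          ENNReal.ofReal (‖z‖ ^ 2) * ENNReal.ofReal (‖gradient φ (x + s • z)‖ ^ 2) := by
        refine lintegral_mono fun x => ?_
        refine (ENNReal.ofReal_le_ofReal (sq_sub_le_integral_gradient hφ x z)).trans ?_
        have hc : Continuous fun s : ℝ => ‖z‖ ^ 2 * ‖gradient φ (x + s • z)‖ ^ 2 := by fun_prop
        rw [ofReal_integral_eq_lintegral_ofReal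
          ((hc.integrableOn_Icc (a := 0) (b := 1)).mono_set Set.Ioc_subset_Icc_self)
          (Eventually.of_forall fun s => by positivity)]
        refine lintegral_mono fun s => ?_
        rw [ENNReal.ofReal_mul (by positivity)]
    _ = ∫⁻ s in Set.Ioc (0 : ℝ) 1, ∫⁻ x,
          ENNReal.ofReal (‖z‖ ^ 2) * ENNReal.ofReal (‖gradient φ (x + s • z)‖ ^ 2) := by
        refine lintegral_lintegral_swap (AEMeasurable.const_mul (Continuous.aemeasurable ?_) _)
        exact ENNReal.continuous_ofReal.comp (by fun_prop)
    _ = ∫⁻ s in Set.Ioc (0 : ℝ) 1,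
          ENNReal.ofReal (‖z‖ ^ 2) * ∫⁻ x, ENNReal.ofReal (‖gradient φ x‖ ^ 2) := by
        refine lintegral_congr fun s => ?_
        rw [lintegral_const_mul' _ _ (by simp),
          lintegral_add_right_eq_self (fun x => ENNReal.ofReal (‖gradient φ x‖ ^ 2)) (s • z)]
    _ = _ := by simp

/-- The half-open cell with index `j` of the cubic grid of side `h`. -/
def gridCell (h : ℝ) (j : Fin N → ℤ) : Set (EuclideanSpace ℝ (Fin N)) :=
  {x | ∀ i, ⌊x i / h⌋ = j i}

lemma measurableSet_gridCell (h : ℝ) (j : Fin N → ℤ) : MeasurableSet (gridCell h j) := by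
  have : gridCell h j = ⋂ i, (fun x : 𝔼 => ⌊x i / h⌋) ⁻¹' {j i} := by
    ext x; simp [gridCell]
  rw [this]
  refine MeasurableSet.iInter fun i => ?_
  have hm : Measurable fun x : 𝔼 => ⌊x i / h⌋ :=
    Int.measurable_floor.comp ((by fun_prop : Continuous fun x : 𝔼 => x i / h).measurable)
  exact hm (measurableSet_singleton _)

lemma gridCell_disjoint (h : ℝ) : Pairwise (Function.onFun Disjoint (gridCell (N := N) h)) := by
  intro i j hij
  rw [Function.onFun, Set.disjoint_left]
  intro x hx hx'
  exact hij (funext fun l => (hx l).symm.trans (hx' l))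

lemma norm_sub_le_of_mem_gridCell {h : ℝ} (hh : 0 < h) {j : Fin N → ℤ} {x y : 𝔼}
    (hx : x ∈ gridCell h j) (hy : y ∈ gridCell h j) : ‖y - x‖ ≤ N * h := by
  have h1 : ∀ i, ‖(y - x) i‖ ^ 2 ≤ h ^ 2 := by
    intro i
    have ha := Int.abs_sub_lt_one_of_floor_eq_floor ((hy i).trans (hx i).symm)
    rw [← sub_div, abs_div, abs_of_pos hh, div_lt_one hh] at ha
    have : ‖(y - x) i‖ = |y i - x i| := by simp
    rw [this]
    gcongr
  rw [EuclideanSpace.norm_eq]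
  apply Real.sqrt_le_iff.2
  refine ⟨by positivity, (Finset.sum_le_sum fun i _ => h1 i).trans ?_⟩
  simp only [Finset.sum_const, Finset.card_univ, Fintype.card_fin, nsmul_eq_mul]
  have h2 : (N : ℝ) ≤ (N : ℝ) ^ 2 := by
    have : N ≤ N ^ 2 := Nat.le_self_pow two_ne_zero N
    exact_mod_cast this
  nlinarith [sq_nonneg h]

lemma ball_subset_gridCell {h : ℝ} (hh : 0 < h) (j : Fin N → ℤ) :
    Metric.ball (WithLp.toLp 2 fun i => (j i + 1 / 2 : ℝ) * h) (h / 2) ⊆ gridCell h j := by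
  intro x hx i
  rw [mem_ball_iff_norm] at hx
  have h1 := (PiLp.norm_apply_le (x - WithLp.toLp 2 fun i => (j i + 1 / 2 : ℝ) * h) i).trans_lt hx
  simp only [PiLp.sub_apply, Real.norm_eq_abs, abs_lt] at h1
  rw [Int.floor_eq_iff, le_div_iff₀ hh, div_lt_iff₀ hh]
  constructor <;> linarith [h1.1, h1.2]

lemma volume_gridCell_lt_top {h : ℝ} (hh : 0 < h) (j : Fin N → ℤ) :
    volume (gridCell h j) < ⊤ := by
  by_cases hne : (gridCell h j).Nonempty
  · obtain ⟨x, hx⟩ := hne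
    refine (measure_mono fun y hy => ?_).trans_lt (measure_closedBall_lt_top (x := x) (r := N * h))
    exact mem_closedBall_iff_norm.2 (norm_sub_le_of_mem_gridCell hh hx hy)
  · rw [Set.not_nonempty_iff_eq_empty.1 hne]; simp

/-- The inscribed ball is enough: only a dimensional constant is lost, and the unit ball's volume
cancels in Poincaré's inequality. -/
lemma le_volume_gridCell {h : ℝ} (hh : 0 < h) (j : Fin N → ℤ) :
    (h / 2) ^ N * volume.real (Metric.ball (0 : 𝔼) 1) ≤ volume.real (gridCell h j) := by
  have h1 := measureReal_mono (μ := volume) (ball_subset_gridCell hh j)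
    (volume_gridCell_lt_top hh j).ne
  rw [measureReal_def, Measure.addHaar_ball_of_pos _ _ (by positivity), ENNReal.toReal_mul,
    ENNReal.toReal_ofReal (by positivity)] at h1
  simpa [measureReal_def] using h1

/-- Two points of one cell differ by some `z` with `‖z‖ ≤ N * h`. The cells being disjoint, the sum
over them is at most an integral over all `x` and all such `z`; Tonelli and the translation estimate
for fixed `z` finish. -/
lemma sum_lintegral_gridCell_le {φ : EuclideanSpace ℝ (Fin N) → ℝ} (hφ : ContDiff ℝ ∞ φ)
    {h : ℝ} (hh : 0 < h) (F : Finset (Fin N → ℤ)) :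
    ∑ j ∈ F, ∫⁻ x in gridCell h j, ∫⁻ y in gridCell h j, ENNReal.ofReal ((φ x - φ y) ^ 2) ≤
      volume (Metric.closedBall (0 : 𝔼) (N * h)) *
        (ENNReal.ofReal ((N * h) ^ 2) * ∫⁻ x, ENNReal.ofReal (‖gradient φ x‖ ^ 2)) := by
  have hφc := hφ.continuous
  set ρ : ℝ := N * h
  set G : 𝔼 → ENNReal := fun x =>
    ∫⁻ z in Metric.closedBall (0 : 𝔼) ρ, ENNReal.ofReal ((φ (x + z) - φ x) ^ 2) with hG
  have hcell : ∀ j, ∀ x ∈ gridCell h j,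
      ∫⁻ y in gridCell h j, ENNReal.ofReal ((φ x - φ y) ^ 2) ≤ G x := by
    intro j x hx
    have hsub : gridCell h j ⊆ Metric.closedBall x ρ := fun y hy =>
      mem_closedBall_iff_norm.2 (norm_sub_le_of_mem_gridCell hh hx hy)
    refine (lintegral_mono_set hsub).trans_eq ?_
    simp only [hG]
    rw [← lintegral_indicator Metric.isClosed_closedBall.measurableSet,
      ← lintegral_indicator Metric.isClosed_closedBall.measurableSet,
      ← lintegral_add_left_eq_self _ x]
    refine lintegral_congr fun z => ?_
    by_cases hz : z ∈ Metric.closedBall (0 : 𝔼) ρ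
    · rw [Set.indicator_of_mem hz, Set.indicator_of_mem (by simpa using hz)]
      congr 1; ring
    · rw [Set.indicator_of_notMem hz, Set.indicator_of_notMem (by simpa using hz)]
  calc _ ≤ ∑ j ∈ F, ∫⁻ x in gridCell h j, G x := by
        refine Finset.sum_le_sum fun j _ => ?_
        exact setLIntegral_mono' (measurableSet_gridCell h j) fun x hx => hcell j x hx
    _ = ∫⁻ x in ⋃ j ∈ F, gridCell h j, G x :=
        (lintegral_biUnion_finset (fun i _ j _ hij => gridCell_disjoint h hij)
          (fun j _ => measurableSet_gridCell h j) _).symm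
    _ ≤ ∫⁻ x, G x := setLIntegral_le_lintegral _ _
    _ = ∫⁻ z in Metric.closedBall (0 : 𝔼) ρ, ∫⁻ x, ENNReal.ofReal ((φ (x + z) - φ x) ^ 2) := by
        refine lintegral_lintegral_swap (Continuous.aemeasurable ?_)
        exact ENNReal.continuous_ofReal.comp (by fun_prop)
    _ ≤ ∫⁻ z in Metric.closedBall (0 : 𝔼) ρ,
          ENNReal.ofReal (ρ ^ 2) * ∫⁻ x, ENNReal.ofReal (‖gradient φ x‖ ^ 2) := by
        refine setLIntegral_mono' Metric.isClosed_closedBall.measurableSet fun z hz => ?_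
        refine (lintegral_translation_sub_sq_le hφ z).trans ?_
        have : ‖z‖ ≤ ρ := by simpa using hz
        gcongr
    _ = _ := by simp [mul_comm]

lemma hasCompactSupport_gradient {φ : EuclideanSpace ℝ (Fin N) → ℝ} (hc : HasCompactSupport φ) :
    HasCompactSupport (gradient φ) :=
  (hc.fderiv ℝ).comp_left (g := (InnerProductSpace.toDual ℝ 𝔼).symm) (map_zero _)

lemma sum_integral_gridCell_le {φ : EuclideanSpace ℝ (Fin N) → ℝ} (hφ : ContDiff ℝ ∞ φ)
    (hc : HasCompactSupport φ) {h : ℝ} (hh : 0 < h) (F : Finset (Fin N → ℤ)) :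
    ∑ j ∈ F, ∫ x in gridCell h j, ∫ y in gridCell h j, (φ x - φ y) ^ 2 ≤
      volume.real (Metric.closedBall (0 : 𝔼) (N * h)) *
        ((N * h) ^ 2 * ∫ x, ‖gradient φ x‖ ^ 2) := by
  have hφc := hφ.continuous
  have hgc := continuous_gradient hφ
  have hg2 : Integrable fun x => ‖gradient φ x‖ ^ 2 := by
    refine Continuous.integrable_of_hasCompactSupport (by fun_prop) ?_
    exact (hasCompactSupport_gradient hc).comp_left (g := fun v => ‖v‖ ^ 2) (by simp)
  have hL2 : ∀ Q : Set 𝔼, MemLp φ 2 (volume.restrict Q) := fun Q =>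
    (hφc.memLp_of_hasCompactSupport hc).restrict Q
  have hconv : ∀ j, ENNReal.ofReal
      (∫ x in gridCell h j, ∫ y in gridCell h j, (φ x - φ y) ^ 2) =
      ∫⁻ x in gridCell h j, ∫⁻ y in gridCell h j, ENNReal.ofReal ((φ x - φ y) ^ 2) := by
    intro j
    have : IsFiniteMeasure (volume.restrict (gridCell h j)) :=
      ⟨by simpa using volume_gridCell_lt_top hh j⟩
    have hin : ∀ x, Integrable (fun y => (φ x - φ y) ^ 2) (volume.restrict (gridCell h j)) :=
      fun x => ((memLp_const (φ x)).sub (hL2 _)).integrable_sq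
    rw [ofReal_integral_eq_lintegral_ofReal]
    · refine lintegral_congr fun x => ?_
      rw [ofReal_integral_eq_lintegral_ofReal (hin x) (Eventually.of_forall fun y => sq_nonneg _)]
    · have hp : MemLp (fun p : 𝔼 × 𝔼 => φ p.1 - φ p.2) 2
          ((volume.restrict (gridCell h j)).prod (volume.restrict (gridCell h j))) :=
        ((hL2 _).comp_fst _).sub ((hL2 _).comp_snd _)
      exact hp.integrable_sq.integral_prod_left
    · exact Eventually.of_forall fun x => integral_nonneg fun y => sq_nonneg _
  have hpos : ∀ j ∈ F, 0 ≤ ∫ x in gridCell h j, ∫ y in gridCell h j, (φ x - φ y) ^ 2 :=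
    fun j _ => integral_nonneg fun x => integral_nonneg fun y => sq_nonneg _
  rw [← ENNReal.ofReal_le_ofReal_iff (by positivity), ENNReal.ofReal_sum_of_nonneg hpos,
    ENNReal.ofReal_mul (by positivity), ENNReal.ofReal_mul (by positivity),
    ofReal_integral_eq_lintegral_ofReal hg2 (Eventually.of_forall fun y => sq_nonneg _),
    ofReal_measureReal measure_closedBall_lt_top.ne]
  simp only [hconv]
  exact sum_lintegral_gridCell_le hφ hh F

/-- Poincaré's inequality on the cells of a grid: up to its averages on the cells, a test function
is small in `L²` when the mesh is. -/
lemma integral_sq_le_sum_gridCell {φ : EuclideanSpace ℝ (Fin N) → ℝ} (hφ : ContDiff ℝ ∞ φ)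
    (hc : HasCompactSupport φ) {h : ℝ} (hh : 0 < h) (F : Finset (Fin N → ℤ))
    (hF : Function.support φ ⊆ ⋃ j ∈ F, gridCell h j) :
    ∫ x, φ x ^ 2 ≤ ∑ j ∈ F, (∫ x in gridCell h j, φ x) ^ 2 / volume.real (gridCell h j) +
      (2 * N) ^ N * (N * h) ^ 2 / 2 * ∫ x, ‖gradient φ x‖ ^ 2 := by
  have hφc := hφ.continuous
  have hL2 : ∀ Q : Set 𝔼, MemLp φ 2 (volume.restrict Q) := fun Q =>
    (hφc.memLp_of_hasCompactSupport hc).restrict Q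
  set κ := volume.real (Metric.ball (0 : 𝔼) 1) with hκ
  have hκpos : 0 < κ := ENNReal.toReal_pos (Metric.measure_ball_pos _ _ one_pos).ne' measure_ball_lt_top.ne
  set q := (h / 2) ^ N * κ with hq
  have hqpos : 0 < q := by positivity
  have hcell : ∀ j, ∫ x in gridCell h j, φ x ^ 2 ≤
      (∫ x in gridCell h j, φ x) ^ 2 / volume.real (gridCell h j) +
        1 / (2 * q) * ∫ x in gridCell h j, ∫ y in gridCell h j, (φ x - φ y) ^ 2 := by
    intro j
    have : IsFiniteMeasure (volume.restrict (gridCell h j)) :=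
      ⟨by simpa using volume_gridCell_lt_top hh j⟩
    have h1 := integral_sq_eq_add_integral_sub_sq (hL2 (gridCell h j))
    have h2 : q ≤ volume.real (gridCell h j) := le_volume_gridCell hh j
    have h3 : (volume.restrict (gridCell h j)).real Set.univ = volume.real (gridCell h j) := by
      simp
    rw [h3] at h1
    set V := volume.real (gridCell h j)
    have hV : 0 < V := hqpos.trans_le h2
    set I := ∫ x in gridCell h j, ∫ y in gridCell h j, (φ x - φ y) ^ 2
    have hI : 0 ≤ I := integral_nonneg fun x => integral_nonneg fun y => sq_nonneg _
    have h4 : ∫ x in gridCell h j, φ x ^ 2 =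
        (∫ x in gridCell h j, φ x) ^ 2 / V + 1 / (2 * V) * I := by
      field_simp
      linarith
    rw [h4]
    gcongr
  have hcover : ∫ x, φ x ^ 2 = ∑ j ∈ F, ∫ x in gridCell h j, φ x ^ 2 := by
    have hint : Integrable fun x => φ x ^ 2 :=
      (hφc.memLp_of_hasCompactSupport hc).integrable_sq
    rw [← integral_biUnion_finset F (fun j _ => measurableSet_gridCell h j)
      (fun i _ j _ hij => gridCell_disjoint h hij) (fun j _ => hint.integrableOn)]
    refine (setIntegral_eq_integral_of_forall_compl_eq_zero fun x hx => ?_).symm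
    have : φ x = 0 := by
      by_contra hne
      exact hx (hF hne)
    simp [this]
  have hball : volume.real (Metric.closedBall (0 : 𝔼) (N * h)) = (N * h) ^ N * κ := by
    rw [Measure.addHaar_real_closedBall _ _ (by positivity)]
    simp [hκ]
  rw [hcover]
  refine (Finset.sum_le_sum fun j _ => hcell j).trans ?_
  rw [Finset.sum_add_distrib, ← Finset.mul_sum]
  have h5 := sum_integral_gridCell_le hφ hc hh F
  rw [hball] at h5
  -- The factor `(2 * N) ^ N` is the volume ratio of the ball of radius `N * h` to the inscribed
  -- ball of radius `h / 2`.
  have h6 : 1 / (2 * q) * (((N * h) ^ N * κ) * ((N * h) ^ 2 * ∫ x, ‖gradient φ x‖ ^ 2)) =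
      (2 * N) ^ N * (N * h) ^ 2 / 2 * ∫ x, ‖gradient φ x‖ ^ 2 := by
    rw [hq]
    have e : (2 * (N : ℝ)) ^ N * (h / 2) ^ N = (N * h) ^ N := by
      rw [← mul_pow]; congr 1; ring
    rw [← e]
    field_simp
  rw [← h6]
  gcongr

end Rellich

/-! ### Forms on `H¹₀` and Rellich's inequality -/

section Sobolev

variable {N : ℕ}

lemma L2_norm_sq {α F : Type*} [MeasurableSpace α] {μ : Measure α} [NormedAddCommGroup F]
    [InnerProductSpace ℝ F] (f : Lp F 2 μ) : ‖f‖ ^ 2 = ∫ x, ‖f x‖ ^ 2 ∂μ := by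
  rw [← real_inner_self_eq_norm_sq, L2.inner_def]
  simp

lemma L2_integral_norm_mul_norm_le {α F : Type*} [MeasurableSpace α] {μ : Measure α}
    [NormedAddCommGroup F] [InnerProductSpace ℝ F] (f g : Lp F 2 μ) :
    ∫ x, ‖f x‖ * ‖g x‖ ∂μ ≤ ‖f‖ * ‖g‖ := by
  have h := integral_mul_norm_le_Lp_mul_Lq (μ := μ) (f := f) (g := g) Real.HolderConjugate.two_two
    (by simpa using Lp.memLp f) (by simpa using Lp.memLp g)
  have e : ∀ k : Lp F 2 μ, (∫ x, ‖k x‖ ^ (2 : ℝ) ∂μ) ^ (1 / (2 : ℝ)) = ‖k‖ := by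
    intro k
    simp only [Real.rpow_two]
    rw [← L2_norm_sq, ← Real.sqrt_eq_rpow, Real.sqrt_sq (norm_nonneg _)]
  rwa [e, e] at h

/-- The coefficients are measurable, bounded, symmetric and uniformly elliptic on `Ω`. -/
structure IsAdmissible (a : EuclideanSpace ℝ (Fin N) → Matrix (Fin N) (Fin N) ℝ)
    (Ω : Set (EuclideanSpace ℝ (Fin N))) : Prop where
  meas : ∀ i j, AEStronglyMeasurable (fun x => a x i j) (volume.restrict Ω)
  bdd : ∃ K : ℝ, ∀ x ∈ Ω, ∀ i j, |a x i j| ≤ K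
  symm : ∀ x ∈ Ω, (a x).IsSymm
  elliptic : UniformlyEllipticOn a Ω

variable {a : EuclideanSpace ℝ (Fin N) → Matrix (Fin N) (Fin N) ℝ}
  {Ω : Set (EuclideanSpace ℝ (Fin N))}

lemma memLp_coord {μ : Measure (EuclideanSpace ℝ (Fin N))}
    (g : Lp (EuclideanSpace ℝ (Fin N)) 2 μ) (i : Fin N) : MemLp (fun x => g x i) 2 μ :=
  (Lp.memLp g).norm.of_le
    ((EuclideanSpace.proj (𝕜 := ℝ) i).continuous.comp_aestronglyMeasurable
      (Lp.aestronglyMeasurable g))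
    (Eventually.of_forall fun x => by simpa using PiLp.norm_apply_le (g x) i)

lemma IsAdmissible.integrable_term (ha : IsAdmissible a Ω) (hΩ : MeasurableSet Ω)
    (g g' : Lp (EuclideanSpace ℝ (Fin N)) 2 (volume.restrict Ω)) (i j : Fin N) :
    Integrable (fun x => a x i j * g x j * g' x i) (volume.restrict Ω) := by
  obtain ⟨K, hK⟩ := ha.bdd
  have h1 : Integrable (fun x => g x j * g' x i) (volume.restrict Ω) :=
    (memLp_coord g j).integrable_mul (memLp_coord g' i)
  have h2 := h1.bdd_mul (c := K) (ha.meas i j) (by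
    filter_upwards [ae_restrict_mem hΩ] with x hx
    exact hK x hx i j)
  simpa [mul_assoc] using h2

lemma IsAdmissible.integrable_energy (ha : IsAdmissible a Ω) (hΩ : MeasurableSet Ω)
    (g g' : Lp (EuclideanSpace ℝ (Fin N)) 2 (volume.restrict Ω)) :
    Integrable (fun x => ∑ i, ∑ j, a x i j * g x j * g' x i) (volume.restrict Ω) :=
  integrable_finsetSum _ fun i _ => integrable_finsetSum _ fun j _ =>
    ha.integrable_term hΩ g g' i j

lemma abs_sum_le {A : Matrix (Fin N) (Fin N) ℝ} {K : ℝ} (hK : ∀ i j, |A i j| ≤ K)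
    (ξ η : EuclideanSpace ℝ (Fin N)) :
    |∑ i, ∑ j, A i j * ξ j * η i| ≤ N * N * K * (‖ξ‖ * ‖η‖) := by
  have h : ∀ i j, |A i j * ξ j * η i| ≤ K * (‖ξ‖ * ‖η‖) := by
    intro i j
    have h1 : |ξ j| ≤ ‖ξ‖ := PiLp.norm_apply_le ξ j
    have h2 : |η i| ≤ ‖η‖ := PiLp.norm_apply_le η i
    have h3 : 0 ≤ K := (abs_nonneg _).trans (hK i j)
    rw [abs_mul, abs_mul, mul_assoc]
    gcongr
    exact hK i j
  calc _ ≤ ∑ i, |∑ j, A i j * ξ j * η i| := Finset.abs_sum_le_sum_abs _ _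
    _ ≤ ∑ i, ∑ j, |A i j * ξ j * η i| :=
        Finset.sum_le_sum fun i _ => Finset.abs_sum_le_sum_abs _ _
    _ ≤ ∑ _i : Fin N, ∑ _j : Fin N, K * (‖ξ‖ * ‖η‖) :=
        Finset.sum_le_sum fun i _ => Finset.sum_le_sum fun j _ => h i j
    _ = _ := by simp; ring

lemma H10_norm_snd_le (u : H10 Ω) : ‖u.1.snd‖ ≤ ‖u‖ := by
  have h := WithLp.prod_norm_sq_eq_of_L2 u.1
  rw [Submodule.norm_coe] at h
  exact le_of_sq_le_sq (by rw [h]; nlinarith [sq_nonneg ‖u.1.fst‖]) (norm_nonneg _)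

/-- The form `∫ a_ij g_j g'_i` on square-integrable vector fields. -/
lemma IsAdmissible.exists_fieldForm (ha : IsAdmissible a Ω) (hΩ : MeasurableSet Ω) :
    ∃ B : Lp (EuclideanSpace ℝ (Fin N)) 2 (volume.restrict Ω) →L[ℝ]
      Lp (EuclideanSpace ℝ (Fin N)) 2 (volume.restrict Ω) →L[ℝ] ℝ,
      ∀ g g', B g g' = ∫ x in Ω, ∑ i, ∑ j, a x i j * g x j * g' x i := by
  let Q : Lp (EuclideanSpace ℝ (Fin N)) 2 (volume.restrict Ω) →
      Lp (EuclideanSpace ℝ (Fin N)) 2 (volume.restrict Ω) → ℝ :=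
    fun g g' => ∫ x in Ω, ∑ i, ∑ j, a x i j * g x j * g' x i
  have add_left : ∀ u v w, Q (u + v) w = Q u w + Q v w := by
    intro u v w
    simp only [Q]
    rw [← integral_add (ha.integrable_energy hΩ _ _) (ha.integrable_energy hΩ _ _)]
    refine integral_congr_ae ?_
    filter_upwards [Lp.coeFn_add u v] with x hx
    simp only [hx, Pi.add_apply, PiLp.add_apply, mul_add, add_mul, Finset.sum_add_distrib]
  have smul_left : ∀ (c : ℝ) u w, Q (c • u) w = c • Q u w := by
    intro c u w
    simp only [Q]
    rw [smul_eq_mul, ← integral_const_mul]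
    refine integral_congr_ae ?_
    filter_upwards [Lp.coeFn_smul c u] with x hx
    simp only [hx, Pi.smul_apply, PiLp.smul_apply, Finset.mul_sum, smul_eq_mul]
    exact Finset.sum_congr rfl fun i _ => Finset.sum_congr rfl fun j _ => by ring
  have add_right : ∀ w u v, Q w (u + v) = Q w u + Q w v := by
    intro w u v
    simp only [Q]
    rw [← integral_add (ha.integrable_energy hΩ _ _) (ha.integrable_energy hΩ _ _)]
    refine integral_congr_ae ?_
    filter_upwards [Lp.coeFn_add u v] with x hx
    simp only [hx, Pi.add_apply, PiLp.add_apply, mul_add, Finset.sum_add_distrib]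
  have smul_right : ∀ (c : ℝ) w u, Q w (c • u) = c • Q w u := by
    intro c w u
    simp only [Q]
    rw [smul_eq_mul, ← integral_const_mul]
    refine integral_congr_ae ?_
    filter_upwards [Lp.coeFn_smul c u] with x hx
    simp only [hx, Pi.smul_apply, PiLp.smul_apply, Finset.mul_sum, smul_eq_mul]
    exact Finset.sum_congr rfl fun i _ => Finset.sum_congr rfl fun j _ => by ring
  obtain ⟨K, hK⟩ := ha.bdd
  have bound : ∀ u v, ‖Q u v‖ ≤ N * N * |K| * ‖u‖ * ‖v‖ := by
    intro u v
    have hint : Integrable (fun x => ‖u x‖ * ‖v x‖) (volume.restrict Ω) :=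
      (Lp.memLp u).norm.integrable_mul (Lp.memLp v).norm
    have hN : (0 : ℝ) ≤ N * N * |K| := by positivity
    calc ‖Q u v‖ ≤ ∫ x in Ω, N * N * |K| * (‖u x‖ * ‖v x‖) := by
          refine norm_integral_le_of_norm_le (hint.const_mul _) ?_
          filter_upwards [ae_restrict_mem hΩ] with x hx
          exact abs_sum_le (fun i j => (hK x hx i j).trans (le_abs_self K)) _ _
      _ = N * N * |K| * ∫ x in Ω, (‖u x‖ * ‖v x‖) := integral_const_mul _ _
      _ ≤ N * N * |K| * (‖u‖ * ‖v‖) :=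
          mul_le_mul_of_nonneg_left (L2_integral_norm_mul_norm_le _ _) hN
      _ = _ := by ring
  exact ⟨(LinearMap.mk₂ ℝ Q add_left smul_left add_right smul_right).mkContinuous₂ _ bound,
    fun u v => rfl⟩

/-- The gradient, as a map from `H¹₀(Ω)` into `L²(Ω)`. -/
def weakGradient (Ω : Set (EuclideanSpace ℝ (Fin N))) :
    H10 Ω →L[ℝ] Lp (EuclideanSpace ℝ (Fin N)) 2 (volume.restrict Ω) :=
  (WithLp.sndL 2 ℝ _ _).comp (H10 Ω).subtypeL

/-- The form `∫ a_ij ∂_j u ∂_i v` as a bounded bilinear form. -/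
def energyForm (ha : IsAdmissible a Ω) (hΩ : MeasurableSet Ω) : H10 Ω →L[ℝ] H10 Ω →L[ℝ] ℝ :=
  (ha.exists_fieldForm hΩ).choose.bilinearComp (weakGradient Ω) (weakGradient Ω)

lemma energyForm_apply (ha : IsAdmissible a Ω) (hΩ : MeasurableSet Ω) (u v : H10 Ω) :
    energyForm ha hΩ u v = weakForm a Ω u v :=
  (ha.exists_fieldForm hΩ).choose_spec u.1.snd v.1.snd

/-- The embedding of `H¹₀(Ω)` into `L²(Ω)`. -/
def toL2 (Ω : Set (EuclideanSpace ℝ (Fin N))) : H10 Ω →L[ℝ] Lp ℝ 2 (volume.restrict Ω) :=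
  (WithLp.fstL 2 ℝ _ _).comp (H10 Ω).subtypeL

/-- The form `∫ u v` as a bounded bilinear form. -/
def massForm (Ω : Set (EuclideanSpace ℝ (Fin N))) : H10 Ω →L[ℝ] H10 Ω →L[ℝ] ℝ :=
  (innerSL ℝ).bilinearComp (toL2 Ω) (toL2 Ω)

lemma massForm_apply (u v : H10 Ω) : massForm Ω u v = ∫ x in Ω, u.1.fst x * v.1.fst x := by
  have : massForm Ω u v = inner ℝ u.1.fst v.1.fst := rfl
  rw [this, L2.inner_def]
  refine integral_congr_ae (Eventually.of_forall fun x => ?_)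
  simp [mul_comm]

lemma massForm_self (u : H10 Ω) : massForm Ω u u = ‖u.1.fst‖ ^ 2 := by
  have : massForm Ω u u = inner ℝ u.1.fst u.1.fst := rfl
  rw [this, real_inner_self_eq_norm_sq]

lemma IsAdmissible.pairEigenvalueBounds_eq (ha : IsAdmissible a Ω) (hΩ : MeasurableSet Ω)
    (k : ℕ) : pairEigenvalueBounds (energyForm ha hΩ) (massForm Ω) k = eigenvalueBounds a Ω k := by
  simp only [pairEigenvalueBounds, eigenvalueBounds, IsPairEigenvector, IsEigenfunction,
    energyForm_apply, massForm_apply]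

/-- A test function defines an element of `H¹₀(Ω)`. -/
lemma exists_testPair {φ : EuclideanSpace ℝ (Fin N) → ℝ} (hφ : ContDiff ℝ ∞ φ)
    (hc : HasCompactSupport φ) (hs : tsupport φ ⊆ Ω) :
    ∃ u : H10 Ω, u.1.fst =ᵐ[volume.restrict Ω] φ ∧
      u.1.snd =ᵐ[volume.restrict Ω] gradient φ := by
  have h1 : MemLp φ 2 (volume.restrict Ω) :=
    (hφ.continuous.memLp_of_hasCompactSupport hc).restrict Ω
  have h2 : MemLp (gradient φ) 2 (volume.restrict Ω) :=
    ((continuous_gradient hφ).memLp_of_hasCompactSupport (hasCompactSupport_gradient hc)).restrict Ω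
  have h3 : WithLp.toLp 2 (h1.toLp, h2.toLp) ∈ testPairs Ω :=
    ⟨φ, hφ, hc, hs, h1.coeFn_toLp, h2.coeFn_toLp⟩
  exact ⟨⟨_, (testPairs Ω).le_topologicalClosure h3⟩, h1.coeFn_toLp, h2.coeFn_toLp⟩

/-- Rellich's theorem for `H¹₀` of a bounded open set, as an inequality: up to finitely many
functionals, the `L²` norm is small with respect to the `H¹` norm. -/
lemma exists_functionals_L2_norm_sq_le (hb : Bornology.IsBounded Ω)
    {ε : ℝ} (hε : 0 < ε) : ∃ (n : ℕ) (l : Fin n → H10 Ω →L[ℝ] ℝ),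
      ∀ u : H10 Ω, ‖u.1.fst‖ ^ 2 ≤ ∑ i, l i u ^ 2 + ε * ‖u‖ ^ 2 := by
  obtain ⟨R, hR⟩ := hb.subset_ball 0
  obtain ⟨h, hh, hhε⟩ : ∃ h : ℝ, 0 < h ∧ (2 * N : ℝ) ^ N * (N * h) ^ 2 / 2 ≤ ε := by
    have hlim : Tendsto (fun h : ℝ => (2 * N : ℝ) ^ N * (N * h) ^ 2 / 2) (𝓝[>] 0) (𝓝 0) := by
      have : Continuous fun h : ℝ => (2 * N : ℝ) ^ N * (N * h) ^ 2 / 2 := by fun_prop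
      simpa using (this.tendsto 0).mono_left nhdsWithin_le_nhds
    obtain ⟨h, h1, h2⟩ := ((hlim.eventually_le_const hε).and self_mem_nhdsWithin).exists
    exact ⟨h, h2, h1⟩
  set F : Finset (Fin N → ℤ) := Fintype.piFinset fun _ => Finset.Icc (-⌈R / h⌉ - 1) (⌈R / h⌉ + 1)
    with hF
  have hcover : Ω ⊆ ⋃ j ∈ F, gridCell h j := by
    intro x hx
    have hxR := mem_ball_zero_iff.1 (hR hx)
    refine Set.mem_biUnion (x := fun i => ⌊x i / h⌋) ?_ fun i => rfl
    simp only [hF, Finset.mem_coe, Fintype.mem_piFinset, Finset.mem_Icc]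
    intro i
    have h1 : |x i| < R := (PiLp.norm_apply_le x i).trans_lt hxR
    have h2 : |x i / h| < R / h := by
      rw [abs_div, abs_of_pos hh]; gcongr
    have h3 := Int.le_ceil (R / h)
    rw [abs_lt] at h2
    constructor
    · rw [Int.le_floor]; push_cast; linarith [h2.1]
    · refine Int.cast_le.1 ((Int.floor_le (x i / h)).trans (?_ : _ ≤ ((⌈R / h⌉ + 1 : ℤ) : ℝ)))
      push_cast; linarith [h2.2]
  have hfin : ∀ j, (volume.restrict Ω) (gridCell h j) ≠ ⊤ := fun j =>
    ((Measure.restrict_apply_le _ _).trans_lt (volume_gridCell_lt_top hh j)).ne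
  -- Cell integrals, normalized so that their squares are exactly the averaged terms in Poincaré's
  -- inequality.
  let L : (Fin N → ℤ) → H10 Ω →L[ℝ] ℝ := fun j => (√(volume.real (gridCell h j)))⁻¹ •
    (innerSL ℝ (indicatorConstLp 2 (measurableSet_gridCell h j) (hfin j) (1 : ℝ))).comp (toL2 Ω)
  have hL : ∀ j u, L j u ^ 2 = (∫ x in gridCell h j, u.1.fst x ∂(volume.restrict Ω)) ^ 2 /
      volume.real (gridCell h j) := by
    intro j u
    have : L j u = (√(volume.real (gridCell h j)))⁻¹ * inner ℝ
      (indicatorConstLp 2 (measurableSet_gridCell h j) (hfin j) (1 : ℝ)) u.1.fst := rfl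
    rw [this, L2.inner_indicatorConstLp_one, mul_pow, inv_pow, Real.sq_sqrt measureReal_nonneg,
      inv_mul_eq_div]
  have key : ∀ u : H10 Ω, ‖u.1.fst‖ ^ 2 ≤ ∑ j ∈ F, L j u ^ 2 + ε * ‖u‖ ^ 2 := by
    -- Both sides are continuous in the `H¹` norm, so test functions suffice.
    have hclosed : IsClosed {u : H10 Ω | ‖toL2 Ω u‖ ^ 2 ≤ ∑ j ∈ F, L j u ^ 2 + ε * ‖u‖ ^ 2} :=
      isClosed_le (by fun_prop) (by fun_prop)
    have hdense : Dense {u : H10 Ω | u.1 ∈ testPairs Ω} := by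
      rw [Subtype.dense_iff]
      intro x hx
      refine closure_mono ?_ hx
      exact fun y hy => ⟨⟨y, (testPairs Ω).le_topologicalClosure hy⟩, hy, rfl⟩
    intro u
    refine hclosed.closure_subset_iff.2 ?_ (hdense u)
    rintro u ⟨φ, hφ, hc, hs, h1, h2⟩
    have hsupp : Function.support φ ⊆ Ω := (subset_tsupport φ).trans hs
    have hφ0 : ∀ x ∉ Ω, φ x = 0 := fun x hx => Function.notMem_support.1 fun h' => hx (hsupp h')
    have hg0 : ∀ x ∉ Ω, gradient φ x = 0 := by
      intro x hx
      have : fderiv ℝ φ x = 0 := by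
        by_contra hne
        exact hx (hs (support_fderiv_subset ℝ hne))
      simp [gradient, this]
    have e1 : ‖u.1.fst‖ ^ 2 = ∫ x, φ x ^ 2 := by
      rw [L2_norm_sq, ← setIntegral_eq_integral_of_forall_compl_eq_zero (s := Ω)
        (f := fun x => φ x ^ 2) (fun x hx => by simp [hφ0 x hx])]
      refine integral_congr_ae ?_
      filter_upwards [h1] with x hx
      simp [hx]
    have e2 : ‖u.1.snd‖ ^ 2 = ∫ x, ‖gradient φ x‖ ^ 2 := by
      rw [L2_norm_sq, ← setIntegral_eq_integral_of_forall_compl_eq_zero (s := Ω)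
        (f := fun x => ‖gradient φ x‖ ^ 2) (fun x hx => by simp [hg0 x hx])]
      refine integral_congr_ae ?_
      filter_upwards [h2] with x hx
      simp [hx]
    have e3 : ∀ j, ∫ x in gridCell h j, u.1.fst x ∂(volume.restrict Ω) =
        ∫ x in gridCell h j, φ x := by
      intro j
      rw [integral_congr_ae (ae_restrict_of_ae h1),
        Measure.restrict_restrict (measurableSet_gridCell h j)]
      refine (setIntegral_eq_of_subset_of_forall_sdiff_eq_zero (measurableSet_gridCell h j)
        Set.inter_subset_left fun x hx => hφ0 x fun hx' => hx.2 ⟨hx.1, hx'⟩).symm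
    have h4 := integral_sq_le_sum_gridCell hφ hc hh F (hsupp.trans hcover)
    have h5 := H10_norm_snd_le u
    show ‖u.1.fst‖ ^ 2 ≤ ∑ j ∈ F, L j u ^ 2 + ε * ‖u‖ ^ 2
    simp only [hL, e3]
    rw [e1]
    refine h4.trans ?_
    rw [← e2]
    gcongr
  refine ⟨F.card, fun i => L (F.equivFin.symm i), fun u => (key u).trans_eq ?_⟩
  congr 1
  rw [← Finset.sum_coe_sort]
  exact (Equiv.sum_comp F.equivFin.symm fun j : F => L j u ^ 2).symm

end Sobolev

/-! ### The Dirichlet problem as a spectral pair -/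

section SpectralPair

variable {N : ℕ} {a : EuclideanSpace ℝ (Fin N) → Matrix (Fin N) (Fin N) ℝ}
  {Ω : Set (EuclideanSpace ℝ (Fin N))}

/-- Test functions that separate `n` points of an open set. -/
lemma exists_bumps (hN : 1 ≤ N) (hΩ : IsOpen Ω) (hne : Ω.Nonempty) (n : ℕ) :
    ∃ (x : Fin n → EuclideanSpace ℝ (Fin N)) (φ : Fin n → EuclideanSpace ℝ (Fin N) → ℝ),
      (∀ i, x i ∈ Ω) ∧ (∀ i, ContDiff ℝ ∞ (φ i) ∧ HasCompactSupport (φ i) ∧ tsupport (φ i) ⊆ Ω) ∧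
      ∀ i j, φ j (x i) = if i = j then 1 else 0 := by
  -- Positive dimension makes every neighbourhood infinite, which provides `n` distinct points.
  have : Nonempty (Fin N) := ⟨⟨0, hN⟩⟩
  obtain ⟨s, hs, hcard⟩ := (infinite_of_mem_nhds hne.some
    (hΩ.mem_nhds hne.some_mem)).exists_subset_card_eq n
  let e := s.equivFinOfCardEq hcard
  let x : Fin n → EuclideanSpace ℝ (Fin N) := fun i => (e.symm i).1
  have hxΩ : ∀ i, x i ∈ Ω := fun i => hs (e.symm i).2
  have hxinj : Function.Injective x := fun i j h => e.symm.injective (Subtype.ext h)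
  have hφ : ∀ i, ∃ φ : EuclideanSpace ℝ (Fin N) → ℝ, ContDiff ℝ ∞ φ ∧ HasCompactSupport φ ∧
      tsupport φ ⊆ Ω ∧ ∀ j, φ (x j) = if j = i then 1 else 0 := by
    intro i
    have hfin : (x '' {j | j ≠ i}).Finite := Set.toFinite _
    have hU : IsOpen (Ω ∩ (x '' {j | j ≠ i})ᶜ) := hΩ.inter hfin.isClosed.isOpen_compl
    have hmem : x i ∈ Ω ∩ (x '' {j | j ≠ i})ᶜ :=
      ⟨hxΩ i, fun ⟨j, hj, hji⟩ => hj (hxinj hji)⟩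
    obtain ⟨φ, h1, h2, h3, -, h5⟩ := exists_contDiff_tsupport_subset (n := ⊤) (hU.mem_nhds hmem)
    refine ⟨φ, h3, h2, h1.trans Set.inter_subset_left, fun j => ?_⟩
    by_cases hji : j = i
    · simp [hji, h5]
    · rw [if_neg hji]
      by_contra hne
      exact (h1 (subset_tsupport φ hne)).2 ⟨j, hji, rfl⟩
  choose φ h1 h2 h3 h4 using hφ
  exact ⟨x, φ, hxΩ, fun i => ⟨h1 i, h2 i, h3 i⟩, fun i j => h4 j i⟩

/-- A combination of bumps with zero mass vanishes almost everywhere, hence everywhere on `Ω` by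
continuity; its value at the `i`-th point is the `i`-th coefficient. -/
lemma massForm_infinite (hN : 1 ≤ N) (hΩ : IsOpen Ω) (hne : Ω.Nonempty) (n : ℕ) :
    ∃ v : Fin n → H10 Ω, ∀ c : Fin n → ℝ, c ≠ 0 →
      0 < massForm Ω (∑ i, c i • v i) (∑ i, c i • v i) := by
  obtain ⟨x, φ, hx, hφ, hδ⟩ := exists_bumps hN hΩ hne n
  choose v hv _ using fun i => exists_testPair (hφ i).1 (hφ i).2.1 (hφ i).2.2
  refine ⟨v, fun c hc => ?_⟩
  rw [massForm_self]
  have hpos : (∑ i, c i • v i).1.fst ≠ 0 := by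
    intro h0
    have h1 : ∑ i, c i • (v i).1.fst = 0 := by
      have : toL2 Ω (∑ i, c i • v i) = 0 := h0
      rwa [map_sum] at this
    have h2 : (fun y => ∑ i, c i * φ i y) =ᵐ[volume.restrict Ω] fun _ => 0 := by
      have h3 := Lp.coeFn_fun_finsetSum Finset.univ fun i => c i • (v i).1.fst
      rw [h1] at h3
      have h4 : ∀ᵐ y ∂(volume.restrict Ω), ∀ i, (c i • (v i).1.fst) y = c i * φ i y := by
        refine ae_all_iff.2 fun i => ?_
        filter_upwards [Lp.coeFn_smul (c i) (v i).1.fst, hv i] with y h5 h6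
        rw [h5, Pi.smul_apply, h6, smul_eq_mul]
      filter_upwards [h3, h4, Lp.coeFn_zero ℝ 2 (volume.restrict Ω)] with y h5 h6 h7
      rw [h7] at h5
      simpa [h6] using h5.symm
    have h8 := Measure.eqOn_open_of_ae_eq h2 hΩ
      (Continuous.continuousOn (continuous_finsetSum _ fun i _ =>
        continuous_const.mul (hφ i).1.continuous)) continuousOn_const
    refine hc (funext fun i => ?_)
    have h9 := h8 (hx i)
    simpa [hδ] using h9
  exact pow_pos (norm_pos_iff.2 hpos) 2

lemma IsAdmissible.mul_norm_sq_le_energyForm (ha : IsAdmissible a Ω) (hΩ : MeasurableSet Ω)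
    {ν : ℝ} (hell : ∀ x ∈ Ω, ∀ ξ : EuclideanSpace ℝ (Fin N),
      ν * ‖ξ‖ ^ 2 ≤ ∑ i, ∑ j, a x i j * ξ i * ξ j) (u : H10 Ω) :
    ν * ‖u.1.snd‖ ^ 2 ≤ energyForm ha hΩ u u := by
  rw [energyForm_apply, L2_norm_sq, ← integral_const_mul]
  refine integral_mono_ae ?_ (ha.integrable_energy hΩ _ _) ?_
  · exact (Lp.memLp u.1.snd).norm.integrable_sq.const_mul _
  · filter_upwards [ae_restrict_mem hΩ] with x hx
    refine (hell x hx _).trans_eq ?_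
    exact Finset.sum_congr rfl fun i _ => Finset.sum_congr rfl fun j _ => by ring

lemma massForm_comm (u v : H10 Ω) : massForm Ω u v = massForm Ω v u :=
  real_inner_comm (toL2 Ω v) (toL2 Ω u)

lemma IsAdmissible.energyForm_comm (ha : IsAdmissible a Ω) (hΩ : MeasurableSet Ω) (u v : H10 Ω) :
    energyForm ha hΩ u v = energyForm ha hΩ v u := by
  rw [energyForm_apply, energyForm_apply]
  refine integral_congr_ae ?_
  filter_upwards [ae_restrict_mem hΩ] with x hx
  rw [Finset.sum_comm]
  refine Finset.sum_congr rfl fun i _ => Finset.sum_congr rfl fun j _ => ?_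
  rw [(ha.symm x hx).apply i j]
  ring

lemma min_mul_norm_sq_le (u : H10 Ω) (ν : ℝ) :
    min ν 1 * ‖u‖ ^ 2 ≤ ν * ‖u.1.snd‖ ^ 2 + ‖u.1.fst‖ ^ 2 := by
  have h1 := WithLp.prod_norm_sq_eq_of_L2 u.1
  rw [Submodule.norm_coe] at h1
  rw [h1]
  have h3 : min ν 1 * ‖u.1.fst‖ ^ 2 ≤ 1 * ‖u.1.fst‖ ^ 2 := by gcongr; exact min_le_right _ _
  have h4 : min ν 1 * ‖u.1.snd‖ ^ 2 ≤ ν * ‖u.1.snd‖ ^ 2 := by gcongr; exact min_le_left _ _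
  linarith

/-- The Dirichlet problem on a bounded nonempty open set defines a spectral pair. -/
theorem IsAdmissible.isSpectralPair (ha : IsAdmissible a Ω) (hN : 1 ≤ N) (hΩ : IsOpen Ω)
    (hne : Ω.Nonempty) (hb : Bornology.IsBounded Ω) :
    IsSpectralPair (energyForm ha hΩ.measurableSet) (massForm Ω) := by
  obtain ⟨ν, hν, hell⟩ := ha.elliptic
  have hE := ha.mul_norm_sq_le_energyForm hΩ.measurableSet hell
  exact
    { symm_energy := ha.energyForm_comm hΩ.measurableSet
      symm_mass := massForm_comm
      energy_nonneg := fun u => (by positivity : (0 : ℝ) ≤ ν * ‖u.1.snd‖ ^ 2).trans (hE u)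
      mass_nonneg := fun u => (sq_nonneg _).trans_eq (massForm_self u).symm
      coercive := ⟨min ν 1, lt_min hν one_pos, fun u =>
        (min_mul_norm_sq_le u ν).trans (add_le_add (hE u) (massForm_self u).ge)⟩
      compact := fun ε hε => by
        obtain ⟨n, l, hl⟩ := exists_functionals_L2_norm_sq_le hb hε
        exact ⟨n, l, fun u => (massForm_self u).trans_le (hl u)⟩
      infinite := massForm_infinite hN hΩ hne }

/-- The `k`-th Dirichlet eigenvalue exists, is nonnegative, and is given by the Courant–Fischer
principle. -/
theorem IsAdmissible.isLeast_dirichletEigenvalue (ha : IsAdmissible a Ω) (hN : 1 ≤ N)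
    (hΩ : IsOpen Ω) (hne : Ω.Nonempty) (hb : Bornology.IsBounded Ω) {k : ℕ} (hk : 1 ≤ k) :
    0 ≤ dirichletEigenvalue a k Ω ∧
      IsLeast (eigenvalueBounds a Ω k) (dirichletEigenvalue a k Ω) ∧
      IsLeast (rayleighBounds (energyForm ha hΩ.measurableSet) (massForm Ω) k)
        (dirichletEigenvalue a k Ω) := by
  have : CompleteSpace (H10 Ω) := (testPairs Ω).isClosed_topologicalClosure.completeSpace_coe
  obtain ⟨τ, h0, h1, h2⟩ := (ha.isSpectralPair hN hΩ hne hb).exists_isLeast hk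
  rw [ha.pairEigenvalueBounds_eq] at h1
  have e : dirichletEigenvalue a k Ω = τ := h1.csInf_eq
  rw [e]
  exact ⟨h0, h1, h2⟩

end SpectralPair

/-! ### Transport by homotheties -/

section Transport

variable {N : ℕ} {Ω Ω' : Set (EuclideanSpace ℝ (Fin N))} {c : EuclideanSpace ℝ (Fin N)} {t : ℝ}

/-- The inverse `y ↦ t⁻¹ (y - c)` of the homothety `x ↦ c + t x`. -/
def unhomothety (c : EuclideanSpace ℝ (Fin N)) (t : ℝ) (y : EuclideanSpace ℝ (Fin N)) :
    EuclideanSpace ℝ (Fin N) := t⁻¹ • (y - c)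

lemma add_smul_unhomothety (ht : 0 < t) (y : EuclideanSpace ℝ (Fin N)) :
    c + t • unhomothety c t y = y := by
  rw [unhomothety, smul_inv_smul₀ ht.ne', add_sub_cancel]

/-- A finite factor, whatever its value, carries over null sets and square-integrability; the exact
Jacobian enters only in `setIntegral_comp_unhomothety`. -/
lemma map_unhomothety (ht : 0 < t) : ∃ k : ENNReal, k ≠ ⊤ ∧
    Measure.map (unhomothety c t) volume = k • volume := by
  refine ⟨_, ENNReal.ofReal_ne_top, Eq.trans ?_ (Measure.map_addHaar_smul volume
    (inv_ne_zero ht.ne'))⟩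
  have : unhomothety c t = (fun x => t⁻¹ • x) ∘ fun y => y - c := rfl
  rw [this, ← Measure.map_map (by fun_prop) (by fun_prop),
    (measurePreserving_sub_right volume c).map_eq]

lemma measurable_unhomothety : Measurable (unhomothety c t) := by
  unfold unhomothety; fun_prop

lemma quasiMeasurePreserving_unhomothety (ht : 0 < t) :
    Measure.QuasiMeasurePreserving (unhomothety c t) volume volume := by
  obtain ⟨k, -, hk⟩ := map_unhomothety (c := c) ht
  exact ⟨measurable_unhomothety, by rw [hk]; exact Measure.smul_absolutelyContinuous⟩

/-- Change of variables under a homothety that maps `Ω` into `Ω'`. -/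
lemma setIntegral_comp_unhomothety (ht : 0 < t) (hmap : ∀ x ∈ Ω, c + t • x ∈ Ω')
    {G : EuclideanSpace ℝ (Fin N) → ℝ} (hG : ∀ x ∉ Ω, G x = 0) :
    ∫ y in Ω', G (unhomothety c t y) = t ^ N * ∫ x in Ω, G x := by
  rw [setIntegral_eq_integral_of_forall_compl_eq_zero (s := Ω) hG,
    setIntegral_eq_integral_of_forall_compl_eq_zero (s := Ω')]
  · simp only [unhomothety]
    rw [integral_sub_right_eq_self (fun y => G (t⁻¹ • y)) c,
      Measure.integral_comp_inv_smul_of_nonneg _ _ ht.le]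
    simp
  · intro y hy
    refine hG _ fun h => hy ?_
    rw [← add_smul_unhomothety (c := c) ht y]
    exact hmap _ h

variable {F : Type*} [NormedAddCommGroup F]

/-- The composition of `u`, extended by `0` outside of `Ω`, with the inverse of a homothety. -/
def transportFun (Ω : Set (EuclideanSpace ℝ (Fin N))) (c : EuclideanSpace ℝ (Fin N)) (t : ℝ)
    (u : EuclideanSpace ℝ (Fin N) → F) (y : EuclideanSpace ℝ (Fin N)) : F :=
  Ω.indicator u (unhomothety c t y)

lemma memLp_transportFun (hΩ : MeasurableSet Ω) (ht : 0 < t)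
    {u : EuclideanSpace ℝ (Fin N) → F} (hu : MemLp u 2 (volume.restrict Ω)) :
    MemLp (transportFun Ω c t u) 2 (volume.restrict Ω') := by
  obtain ⟨k, hk, hmap⟩ := map_unhomothety (c := c) ht
  have h1 : MemLp (Ω.indicator u) 2 volume := (memLp_indicator_iff_restrict hΩ).2 hu
  have h2 : MemLp (Ω.indicator u) 2 (Measure.map (unhomothety c t) volume) := by
    rw [hmap]; exact h1.smul_measure hk
  exact ((memLp_map_measure_iff h2.1 measurable_unhomothety.aemeasurable).1 h2).restrict Ω'

lemma transportFun_ae_eq (hΩ : MeasurableSet Ω) (ht : 0 < t)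
    {u v : EuclideanSpace ℝ (Fin N) → F} (h : u =ᵐ[volume.restrict Ω] v) :
    transportFun Ω c t u =ᵐ[volume.restrict Ω'] transportFun Ω c t v :=
  ae_restrict_of_ae ((quasiMeasurePreserving_unhomothety ht).ae_eq
    ((ae_eq_restrict_iff_indicator_ae_eq hΩ).1 h))

variable [InnerProductSpace ℝ F]

/-- Transport of square-integrable functions by a homothety. -/
def transportLp (hΩ : MeasurableSet Ω) (ht : 0 < t) (c : EuclideanSpace ℝ (Fin N))
    (Ω' : Set (EuclideanSpace ℝ (Fin N))) :
    Lp F 2 (volume.restrict Ω) →ₗ[ℝ] Lp F 2 (volume.restrict Ω') where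
  toFun u := (memLp_transportFun hΩ ht (c := c) (Lp.memLp u)).toLp
  map_add' u v := by
    rw [← MemLp.toLp_add]
    refine MemLp.toLp_congr _ _ ((transportFun_ae_eq hΩ ht (Lp.coeFn_add u v)).trans ?_)
    refine Eventually.of_forall fun y => ?_
    simp only [transportFun, Pi.add_apply]
    rw [Set.indicator_add']; rfl
  map_smul' r u := by
    rw [RingHom.id_apply, ← MemLp.toLp_const_smul]
    refine MemLp.toLp_congr _ _ ((transportFun_ae_eq hΩ ht (Lp.coeFn_smul r u)).trans ?_)
    refine Eventually.of_forall fun y => ?_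
    simp only [transportFun, Pi.smul_apply]
    rw [Pi.smul_def, Set.indicator_const_smul_apply]

lemma coeFn_transportLp (hΩ : MeasurableSet Ω) (ht : 0 < t) (u : Lp F 2 (volume.restrict Ω)) :
    transportLp hΩ ht c Ω' u =ᵐ[volume.restrict Ω'] transportFun Ω c t u :=
  MemLp.coeFn_toLp (memLp_transportFun hΩ ht (Lp.memLp u))

lemma norm_transportLp_sq (hΩ : MeasurableSet Ω) (ht : 0 < t) (hmap : ∀ x ∈ Ω, c + t • x ∈ Ω')
    (u : Lp F 2 (volume.restrict Ω)) : ‖transportLp hΩ ht c Ω' u‖ ^ 2 = t ^ N * ‖u‖ ^ 2 := by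
  have h1 : ∫ x, ‖transportLp hΩ ht c Ω' u x‖ ^ 2 ∂(volume.restrict Ω') =
      ∫ y in Ω', ‖Ω.indicator u (unhomothety c t y)‖ ^ 2 := by
    refine integral_congr_ae ?_
    filter_upwards [coeFn_transportLp (c := c) (Ω' := Ω') hΩ ht u] with x hx
    rw [hx, transportFun]
  rw [L2_norm_sq, h1, setIntegral_comp_unhomothety ht hmap (G := fun x => ‖Ω.indicator u x‖ ^ 2)
    (fun x hx => by simp [hx]), L2_norm_sq]
  congr 1
  refine setIntegral_congr_fun hΩ fun x hx => ?_
  simp [hx]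

/-- Transport of square-integrable functions by a homothety, as a bounded operator. -/
def transportL (hΩ : MeasurableSet Ω) (ht : 0 < t) (hmap : ∀ x ∈ Ω, c + t • x ∈ Ω') :
    Lp F 2 (volume.restrict Ω) →L[ℝ] Lp F 2 (volume.restrict Ω') :=
  (transportLp hΩ ht c Ω').mkContinuous (√(t ^ N)) fun u => by
    refine le_of_sq_le_sq ?_ (by positivity)
    rw [norm_transportLp_sq hΩ ht hmap, mul_pow, Real.sq_sqrt (by positivity)]

/-- Transport of pairs `(u, ∇u)` by a homothety. -/
def transportPair (hΩ : MeasurableSet Ω) (ht : 0 < t) (hmap : ∀ x ∈ Ω, c + t • x ∈ Ω') :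
    L2Pair Ω →L[ℝ] L2Pair Ω' :=
  (WithLp.prodContinuousLinearEquiv 2 ℝ (Lp ℝ 2 (volume.restrict Ω'))
      (Lp (EuclideanSpace ℝ (Fin N)) 2 (volume.restrict Ω'))).symm.toContinuousLinearMap.comp
    (((transportL hΩ ht hmap).comp (WithLp.fstL 2 ℝ _ _)).prod
      (t⁻¹ • (transportL hΩ ht hmap).comp (WithLp.sndL 2 ℝ _ _)))

lemma transportPair_fst (hΩ : MeasurableSet Ω) (ht : 0 < t) (hmap : ∀ x ∈ Ω, c + t • x ∈ Ω')
    (p : L2Pair Ω) : (transportPair hΩ ht hmap p).fst = transportLp hΩ ht c Ω' p.fst := rfl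

lemma transportPair_snd (hΩ : MeasurableSet Ω) (ht : 0 < t) (hmap : ∀ x ∈ Ω, c + t • x ∈ Ω')
    (p : L2Pair Ω) : (transportPair hΩ ht hmap p).snd = t⁻¹ • transportLp hΩ ht c Ω' p.snd := rfl

lemma coeFn_transportPair_snd (hΩ : MeasurableSet Ω) (ht : 0 < t)
    (hmap : ∀ x ∈ Ω, c + t • x ∈ Ω') (p : L2Pair Ω) :
    (transportPair hΩ ht hmap p).snd =ᵐ[volume.restrict Ω']
      fun y => t⁻¹ • Ω.indicator p.snd (unhomothety c t y) := by
  rw [transportPair_snd]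
  filter_upwards [Lp.coeFn_smul t⁻¹ (transportLp hΩ ht c Ω' p.snd),
    coeFn_transportLp (c := c) (Ω' := Ω') hΩ ht p.snd] with y h1 h2
  rw [h1, Pi.smul_apply, h2, transportFun]

/-- The inverse homothety as a homeomorphism. -/
def unhomothetyHomeomorph (c : EuclideanSpace ℝ (Fin N)) (ht : 0 < t) :
    EuclideanSpace ℝ (Fin N) ≃ₜ EuclideanSpace ℝ (Fin N) :=
  (Homeomorph.subRight c).trans (Homeomorph.smulOfNeZero t⁻¹ (inv_ne_zero ht.ne'))

lemma coe_unhomothetyHomeomorph (ht : 0 < t) :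
    (unhomothetyHomeomorph c ht : EuclideanSpace ℝ (Fin N) → _) = unhomothety c t := rfl

lemma gradient_comp_unhomothety {φ : EuclideanSpace ℝ (Fin N) → ℝ} (hφ : ContDiff ℝ ∞ φ)
    (y : EuclideanSpace ℝ (Fin N)) :
    gradient (φ ∘ unhomothety c t) y = t⁻¹ • gradient φ (unhomothety c t y) := by
  have h1 : HasFDerivAt (unhomothety c t)
      (t⁻¹ • ContinuousLinearMap.id ℝ (EuclideanSpace ℝ (Fin N))) y :=
    ((hasFDerivAt_id y).sub_const c).const_smul t⁻¹
  have h2 := (hφ.differentiable (by simp) (unhomothety c t y)).hasFDerivAt.comp y h1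
  rw [gradient, h2.fderiv, gradient]
  simp

lemma transportPair_mem_testPairs (hΩ : MeasurableSet Ω) (ht : 0 < t)
    (hmap : ∀ x ∈ Ω, c + t • x ∈ Ω') {p : L2Pair Ω} (hp : p ∈ testPairs Ω) :
    transportPair hΩ ht hmap p ∈ testPairs Ω' := by
  obtain ⟨φ, hφ, hc, hs, h1, h2⟩ := hp
  have hφ0 : Ω.indicator φ = φ :=
    Set.indicator_eq_self.2 ((subset_tsupport φ).trans hs)
  have hg0 : Ω.indicator (gradient φ) = gradient φ := by
    refine Set.indicator_eq_self.2 fun x hx => hs (support_fderiv_subset ℝ fun h => hx ?_)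
    simp [gradient, h]
  refine ⟨φ ∘ unhomothety c t, ?_, ?_, ?_, ?_, ?_⟩
  · refine hφ.comp ?_
    unfold unhomothety
    fun_prop
  · rw [← coe_unhomothetyHomeomorph ht]
    exact hc.comp_homeomorph _
  · rw [← coe_unhomothetyHomeomorph ht, tsupport_comp_eq_preimage]
    intro y hy
    rw [← add_smul_unhomothety (c := c) ht y]
    exact hmap _ (hs hy)
  · rw [transportPair_fst]
    filter_upwards [coeFn_transportLp (c := c) (Ω' := Ω') hΩ ht p.fst,
      transportFun_ae_eq (c := c) (Ω' := Ω') hΩ ht h1] with y h3 h4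
    rw [h3, h4, transportFun, hφ0, Function.comp_apply]
  · filter_upwards [coeFn_transportPair_snd hΩ ht hmap p,
      transportFun_ae_eq (c := c) (Ω' := Ω') hΩ ht h2] with y h3 h4
    rw [transportFun, transportFun, hg0] at h4
    rw [h3, h4, gradient_comp_unhomothety hφ]

/-- Transport of `H¹₀` functions by a homothety. -/
def transportH10 (hΩ : MeasurableSet Ω) (ht : 0 < t) (hmap : ∀ x ∈ Ω, c + t • x ∈ Ω') :
    H10 Ω →ₗ[ℝ] H10 Ω' :=
  (transportPair hΩ ht hmap).toLinearMap.restrict fun _ hp =>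
    map_mem_closure (transportPair hΩ ht hmap).continuous hp
      fun _ => transportPair_mem_testPairs hΩ ht hmap

lemma massForm_transportH10 (hΩ : MeasurableSet Ω) (ht : 0 < t)
    (hmap : ∀ x ∈ Ω, c + t • x ∈ Ω') (u : H10 Ω) :
    massForm Ω' (transportH10 hΩ ht hmap u) (transportH10 hΩ ht hmap u) =
      t ^ N * massForm Ω u u := by
  rw [massForm_self, massForm_self]
  exact norm_transportLp_sq hΩ ht hmap u.1.fst

/-- The change of variables yields `t ^ N`, the two gradients yield `t⁻¹ ^ 2`, and `C` compares the
forms pointwise. -/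
lemma integral_energy_transport_le {a a' : EuclideanSpace ℝ (Fin N) → Matrix (Fin N) (Fin N) ℝ}
    (ha : IsAdmissible a Ω) (ha' : IsAdmissible a' Ω') (hΩ : MeasurableSet Ω) (ht : 0 < t)
    (hmap : ∀ x ∈ Ω, c + t • x ∈ Ω') {C : ℝ}
    (hC : ∀ x ∈ Ω, ∀ ξ : EuclideanSpace ℝ (Fin N),
      ∑ i, ∑ j, a' (c + t • x) i j * ξ j * ξ i ≤ C * ∑ i, ∑ j, a x i j * ξ j * ξ i)
    (g : Lp (EuclideanSpace ℝ (Fin N)) 2 (volume.restrict Ω))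
    {g' : EuclideanSpace ℝ (Fin N) → EuclideanSpace ℝ (Fin N)}
    (hg' : g' =ᵐ[volume.restrict Ω'] fun y => t⁻¹ • Ω.indicator g (unhomothety c t y)) :
    ∫ y in Ω', ∑ i, ∑ j, a' y i j * g' y j * g' y i ≤
      t ^ N * (t⁻¹ ^ 2 * C) * ∫ x in Ω, ∑ i, ∑ j, a x i j * g x j * g x i := by
  set G : EuclideanSpace ℝ (Fin N) → ℝ := fun x => t⁻¹ ^ 2 *
    ∑ i, ∑ j, a' (c + t • x) i j * Ω.indicator g x j * Ω.indicator g x i with hG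
  have h1 : ∫ y in Ω', ∑ i, ∑ j, a' y i j * g' y j * g' y i =
      ∫ y in Ω', G (unhomothety c t y) := by
    refine integral_congr_ae ?_
    filter_upwards [hg'] with y hy
    simp only [hG, hy, add_smul_unhomothety ht, Finset.mul_sum, PiLp.smul_apply, smul_eq_mul]
    exact Finset.sum_congr rfl fun i _ => Finset.sum_congr rfl fun j _ => by ring
  have hG0 : ∀ x ∉ Ω, G x = 0 := fun x hx => by
    have e : Ω.indicator g x = 0 := Set.indicator_of_notMem hx _
    simp [hG, e]
  rw [h1, setIntegral_comp_unhomothety ht hmap hG0, mul_assoc]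
  refine mul_le_mul_of_nonneg_left ?_ (pow_nonneg ht.le N)
  rw [← integral_const_mul]
  have hGle : ∀ x ∈ Ω, G x ≤ t⁻¹ ^ 2 * C * ∑ i, ∑ j, a x i j * g x j * g x i := by
    intro x hx
    have e : Ω.indicator g x = g x := Set.indicator_of_mem hx _
    simp only [hG, e]
    rw [mul_assoc]
    exact mul_le_mul_of_nonneg_left (hC x hx _) (by positivity)
  -- Ellipticity of `a'` makes `G` nonnegative, so its integrability need not be checked.
  refine integral_mono_of_nonneg ?_ ((ha.integrable_energy hΩ _ _).const_mul _) ?_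
  · filter_upwards [ae_restrict_mem hΩ] with x hx
    obtain ⟨ν, hν, hell⟩ := ha'.elliptic
    have h2 := hell _ (hmap x hx) (g x)
    have h3 : 0 ≤ ∑ i, ∑ j, a' (c + t • x) i j * g x j * g x i := by
      refine (by positivity : (0 : ℝ) ≤ ν * ‖g x‖ ^ 2).trans (h2.trans_eq ?_)
      exact Finset.sum_congr rfl fun i _ => Finset.sum_congr rfl fun j _ => by ring
    have e : Ω.indicator g x = g x := Set.indicator_of_mem hx _
    simp only [hG, e, Pi.zero_apply]
    positivity
  · filter_upwards [ae_restrict_mem hΩ] with x hx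
    exact hGle x hx

lemma energyForm_transportH10_le {a a' : EuclideanSpace ℝ (Fin N) → Matrix (Fin N) (Fin N) ℝ}
    (ha : IsAdmissible a Ω) (ha' : IsAdmissible a' Ω') (hΩ : MeasurableSet Ω)
    (hΩ' : MeasurableSet Ω') (ht : 0 < t) (hmap : ∀ x ∈ Ω, c + t • x ∈ Ω') {C : ℝ}
    (hC : ∀ x ∈ Ω, ∀ ξ : EuclideanSpace ℝ (Fin N),
      ∑ i, ∑ j, a' (c + t • x) i j * ξ j * ξ i ≤ C * ∑ i, ∑ j, a x i j * ξ j * ξ i)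
    (u : H10 Ω) :
    energyForm ha' hΩ' (transportH10 hΩ ht hmap u) (transportH10 hΩ ht hmap u) ≤
      t ^ N * (t⁻¹ ^ 2 * C) * energyForm ha hΩ u u := by
  rw [energyForm_apply, energyForm_apply]
  exact integral_energy_transport_le ha ha' hΩ ht hmap hC u.1.snd
    (coeFn_transportPair_snd hΩ ht hmap u.1)

/-- Comparison of the Dirichlet eigenvalues on `Ω` and `Ω'` when a homothety maps `Ω` into `Ω'`. -/
theorem dirichletEigenvalue_le_of_homothety
    {a a' : EuclideanSpace ℝ (Fin N) → Matrix (Fin N) (Fin N) ℝ}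
    (ha : IsAdmissible a Ω) (ha' : IsAdmissible a' Ω') (hN : 1 ≤ N) (hΩ : IsOpen Ω)
    (hΩ' : IsOpen Ω') (hne : Ω.Nonempty) (hb : Bornology.IsBounded Ω)
    (hb' : Bornology.IsBounded Ω') (ht : 0 < t) (hmap : ∀ x ∈ Ω, c + t • x ∈ Ω') {C : ℝ}
    (hC0 : 0 ≤ C) (hC : ∀ x ∈ Ω, ∀ ξ : EuclideanSpace ℝ (Fin N),
      ∑ i, ∑ j, a' (c + t • x) i j * ξ j * ξ i ≤ C * ∑ i, ∑ j, a x i j * ξ j * ξ i)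
    {k : ℕ} (hk : 1 ≤ k) :
    dirichletEigenvalue a' k Ω' ≤ t⁻¹ ^ 2 * C * dirichletEigenvalue a k Ω := by
  have hne' : Ω'.Nonempty := ⟨_, hmap _ hne.some_mem⟩
  have h1 := (ha.isLeast_dirichletEigenvalue hN hΩ hne hb hk).2.2
  have h2 := (ha'.isLeast_dirichletEigenvalue hN hΩ' hne' hb' hk).2.2
  have h3 := (ha.isSpectralPair hN hΩ hne hb).rayleighBounds_map
    (transportH10 hΩ.measurableSet ht hmap) (p := t ^ N) (q := t ^ N * (t⁻¹ ^ 2 * C))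
    (by positivity) (by positivity) (massForm_transportH10 hΩ.measurableSet ht hmap)
    (energyForm_transportH10_le ha ha' hΩ.measurableSet hΩ'.measurableSet ht hmap hC) h1.1
  have e : t ^ N * (t⁻¹ ^ 2 * C) / t ^ N = t⁻¹ ^ 2 * C := by field_simp
  rw [e] at h3
  exact h2.2 h3

end Transport

/-! ### Convex sets and Hausdorff convergence -/

section ConvexGeometry

/-- A ball that is close to an open convex set has its half contained in it. -/
lemma ball_half_subset_of_subset_add_ball {E : Type*} [NormedAddCommGroup E]
    [InnerProductSpace ℝ E] [CompleteSpace E] {S : Set E} (hS : IsOpen S) (hconv : Convex ℝ S)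
    {x₀ : E} {r ε : ℝ} (hr : 0 < r) (hε : ε ≤ r / 2)
    (hsub : Metric.ball x₀ r ⊆ S + Metric.ball (0 : E) ε) : Metric.ball x₀ (r / 2) ⊆ S := by
  intro y hy
  by_contra hyS
  obtain ⟨f, hf⟩ := geometric_hahn_banach_open_point hconv hS hyS
  set v : E := (InnerProductSpace.toDual ℝ E).symm f with hv
  have hfv : ∀ z, f z = inner ℝ v z := fun z => by
    rw [hv, InnerProductSpace.toDual_symm_apply]
  obtain ⟨z₀, hz₀, -⟩ := Set.mem_add.1 (hsub (Metric.mem_ball_self hr))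
  have hv0 : v ≠ 0 := by
    intro h0
    have := hf z₀ hz₀
    simp [hfv, h0] at this
  have hvpos : 0 < ‖v‖ := norm_pos_iff.2 hv0
  -- Moving `y` by `r / 2` along the normal `v` raises `f` by `‖v‖ * (r / 2)`, whereas on `S + ball
  -- 0 ε` it stays below `f y + ‖v‖ * ε`. This contradicts `ε ≤ r / 2`.
  have hp : y + (r / 2 / ‖v‖) • v ∈ Metric.ball x₀ r := by
    rw [mem_ball_iff_norm] at hy ⊢
    have h1 : ‖(r / 2 / ‖v‖) • v‖ = r / 2 := by
      rw [norm_smul, Real.norm_of_nonneg (by positivity), div_mul_cancel₀ _ hvpos.ne']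
    calc ‖y + (r / 2 / ‖v‖) • v - x₀‖ = ‖(y - x₀) + (r / 2 / ‖v‖) • v‖ := by congr 1; abel
      _ ≤ ‖y - x₀‖ + r / 2 := (norm_add_le _ _).trans_eq (by rw [h1])
      _ < r := by linarith
  obtain ⟨z, hz, w, hw, hzw⟩ := Set.mem_add.1 (hsub hp)
  have h1 := hf z hz
  have h2 : f w ≤ ‖v‖ * ε := by
    rw [hfv]
    exact (real_inner_le_norm _ _).trans
      (mul_le_mul_of_nonneg_left (mem_ball_zero_iff.1 hw).le hvpos.le)
  have h3 := congrArg f hzw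
  rw [map_add, map_add, map_smul, hfv v, real_inner_self_eq_norm_sq, smul_eq_mul] at h3
  have h4 : r / 2 / ‖v‖ * ‖v‖ ^ 2 = ‖v‖ * (r / 2) := by field_simp
  rw [h4] at h3
  have h5 := mul_le_mul_of_nonneg_left hε hvpos.le
  linarith

/-- A contraction towards the centre of a ball contained in a convex set maps the nearby sets into
that convex set. -/
lemma homothety_mem_of_subset_add_ball {E : Type*} [NormedAddCommGroup E] [NormedSpace ℝ E]
    {S : Set E} (hconv : Convex ℝ S) {x₀ : E} {ρ ε t : ℝ} (hball : Metric.ball x₀ ρ ⊆ S)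
    (ht0 : 0 < t) (ht1 : t < 1) (hε : t * ε ≤ (1 - t) * ρ) {w : E}
    (hw : w ∈ S + Metric.ball (0 : E) ε) : (1 - t) • x₀ + t • w ∈ S := by
  obtain ⟨z, hz, b, hb, rfl⟩ := Set.mem_add.1 hw
  have hs : 0 < 1 - t := by linarith
  -- The error `b` is moved from the point `z` to the centre, where the ball leaves room for it.
  have hq : x₀ + (t / (1 - t)) • b ∈ S := by
    refine hball (mem_ball_iff_norm.2 ?_)
    rw [add_sub_cancel_left, norm_smul, Real.norm_of_nonneg (by positivity), div_mul_eq_mul_div,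
      div_lt_iff₀ hs]
    have := mul_lt_mul_of_pos_left (mem_ball_zero_iff.1 hb) ht0
    linarith
  have h1 := hconv hq hz hs.le ht0.le (by ring)
  have h2 : (1 - t) • (x₀ + (t / (1 - t)) • b) + t • z = (1 - t) • x₀ + t • (z + b) := by
    rw [smul_add, smul_smul, mul_div_cancel₀ _ hs.ne', smul_add]
    abel
  rwa [h2] at h1

variable {N : ℕ}

lemma convex_of_tendsto_nonemptyCompacts {E : Type*} [NormedAddCommGroup E] [NormedSpace ℝ E]
    {K : ℕ → TopologicalSpace.NonemptyCompacts E} {L : TopologicalSpace.NonemptyCompacts E}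
    (hK : ∀ n, Convex ℝ (K n : Set E)) (hL : Tendsto K atTop (𝓝 L)) : Convex ℝ (L : Set E) := by
  intro x hx y hy p q hp hq hpq
  rw [← L.isCompact.isClosed.closure_eq, Metric.mem_closure_iff]
  intro ε hε
  obtain ⟨n, hn⟩ := (Metric.tendsto_nhds.1 hL (ε / 2) (by positivity)).exists
  have hfin : Metric.hausdorffEDist (K n : Set E) L ≠ ⊤ :=
    Metric.hausdorffEDist_ne_top_of_nonempty_of_bounded (K n).nonempty L.nonempty
      (K n).isCompact.isBounded L.isCompact.isBounded
  rw [Metric.NonemptyCompacts.dist_eq] at hn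
  obtain ⟨x', hx', hxx'⟩ := Metric.exists_dist_lt_of_hausdorffDist_lt' hx hn hfin
  obtain ⟨y', hy', hyy'⟩ := Metric.exists_dist_lt_of_hausdorffDist_lt' hy hn hfin
  obtain ⟨z, hz, hzz⟩ :=
    Metric.exists_dist_lt_of_hausdorffDist_lt (hK n hx' hy' hp hq hpq) hn hfin
  refine ⟨z, hz, (dist_triangle _ (p • x' + q • y') _).trans_lt ?_⟩
  have h1 : dist (p • x + q • y) (p • x' + q • y') ≤ ε / 2 := by
    rw [dist_comm] at hxx' hyy'
    rw [dist_eq_norm] at hxx' hyy' ⊢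
    calc ‖p • x + q • y - (p • x' + q • y')‖ = ‖p • (x - x') + q • (y - y')‖ := by
          congr 1; rw [smul_sub, smul_sub]; abel
      _ ≤ p * ‖x - x'‖ + q * ‖y - y'‖ := by
          refine (norm_add_le _ _).trans_eq ?_
          rw [norm_smul, norm_smul, Real.norm_of_nonneg hp, Real.norm_of_nonneg hq]
      _ ≤ p * (ε / 2) + q * (ε / 2) := by gcongr
      _ = ε / 2 := by rw [← add_mul, hpq, one_mul]
  linarith

lemma nonempty_of_mem_convexClass {D Ω : Set (EuclideanSpace ℝ (Fin N))} {m : ℝ} (hm : 0 < m)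
    (hΩ : Ω ∈ convexClass D m) : Ω.Nonempty := by
  rw [Set.nonempty_iff_ne_empty]
  rintro rfl
  have := hΩ.2.2.2
  simp [hm.not_ge] at this

/-- The sets of the class `C_m(D)` all contain a ball of some fixed radius. -/
theorem exists_forall_ball_subset {D : Set (EuclideanSpace ℝ (Fin N))} (hD : IsCompact D) {m : ℝ}
    (hm : 0 < m) : ∃ r : ℝ, 0 < r ∧ ∀ Ω ∈ convexClass D m, ∃ x₀, Metric.ball x₀ r ⊆ Ω := by
  by_contra! hcon
  choose Ω hΩ hno using fun n : ℕ => hcon (1 / (n + 1 : ℝ)) (by positivity)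
  have hcl : ∀ n, closure (Ω n) ⊆ D := fun n => closure_minimal (hΩ n).1 hD.isClosed
  let K : ℕ → TopologicalSpace.NonemptyCompacts (EuclideanSpace ℝ (Fin N)) := fun n =>
    ⟨⟨closure (Ω n), hD.of_isClosed_subset isClosed_closure (hcl n)⟩,
      (nonempty_of_mem_convexClass hm (hΩ n)).closure⟩
  -- Blaschke selection: sets without balls of radius `1 / (n + 1)` would accumulate at a compact
  -- convex `L`. The limit keeps measure at least `m`, so it contains a ball, half of which lies in
  -- a late `Ω (φ n)`.
  obtain ⟨L, -, φ, hφ, hL⟩ :=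
    (TopologicalSpace.NonemptyCompacts.isCompact_subsets_of_isCompact hD).tendsto_subseq
      (x := K) fun n => hcl n
  have hconv : Convex ℝ (L : Set (EuclideanSpace ℝ (Fin N))) :=
    convex_of_tendsto_nonemptyCompacts (fun n => (hΩ (φ n)).2.2.1.closure) hL
  have hdist : ∀ ε : ℝ, 0 < ε → ∀ᶠ n in atTop,
      Metric.hausdorffDist (closure (Ω (φ n))) (L : Set (EuclideanSpace ℝ (Fin N))) < ε :=
    fun ε hε => Metric.tendsto_nhds.1 hL ε hε
  have hfin : ∀ n, Metric.hausdorffEDist (closure (Ω n))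
      (L : Set (EuclideanSpace ℝ (Fin N))) ≠ ⊤ := fun n =>
    Metric.hausdorffEDist_ne_top_of_nonempty_of_bounded (K n).nonempty L.nonempty
      (K n).isCompact.isBounded L.isCompact.isBounded
  have hvol : ENNReal.ofReal m ≤ volume (L : Set (EuclideanSpace ℝ (Fin N))) := by
    refine ge_of_tendsto ((tendsto_measure_cthickening_of_isCompact L.isCompact).mono_left
      (nhdsWithin_le_nhds (s := Set.Ioi 0))) ?_
    filter_upwards [self_mem_nhdsWithin] with ε hε
    obtain ⟨n, hn⟩ := (hdist ε hε).exists
    rw [← (hΩ (φ n)).2.2.2]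
    refine measure_mono fun x hx => ?_
    obtain ⟨y, hy, hxy⟩ := Metric.exists_dist_lt_of_hausdorffDist_lt (subset_closure hx) hn
      (hfin _)
    exact Metric.mem_cthickening_of_dist_le x y ε _ hy hxy.le
  -- The frontier of a convex set is null, so a convex set of positive measure has interior.
  have hint : (interior (L : Set (EuclideanSpace ℝ (Fin N)))).Nonempty := by
    rw [Set.nonempty_iff_ne_empty]
    intro h0
    have h1 := hconv.addHaar_frontier volume
    rw [frontier, h0, L.isCompact.isClosed.closure_eq, Set.sdiff_empty] at h1
    rw [h1] at hvol
    simp [hm.not_ge] at hvol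
  obtain ⟨x₀, hx₀⟩ := hint
  obtain ⟨r, hr, hball⟩ := Metric.isOpen_iff.1 isOpen_interior x₀ hx₀
  obtain ⟨n, hn, hn'⟩ := ((hdist (r / 4) (by positivity)).and
    ((tendsto_one_div_add_atTop_nhds_zero_nat.comp hφ.tendsto_atTop).eventually_le_const
      (by positivity : 0 < r / 2))).exists
  have hsub : Metric.ball x₀ r ⊆ Ω (φ n) + Metric.ball (0 : EuclideanSpace ℝ (Fin N)) (r / 2) := by
    intro x hx
    obtain ⟨y, hy, hxy⟩ :=
      Metric.exists_dist_lt_of_hausdorffDist_lt' (interior_subset (hball hx)) hn (hfin _)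
    obtain ⟨z, hz, hyz⟩ := Metric.mem_closure_iff.1 hy (r / 4) (by positivity)
    refine Set.mem_add.2 ⟨z, hz, x - z, mem_ball_zero_iff.2 ?_, by abel⟩
    rw [← dist_eq_norm]
    calc dist x z ≤ dist x y + dist y z := dist_triangle _ _ _
      _ < r / 2 := by rw [dist_comm x y]; linarith
  have hhalf := ball_half_subset_of_subset_add_ball (hΩ (φ n)).2.1 (hΩ (φ n)).2.2.1 hr le_rfl hsub
  exact hno (φ n) x₀ ((Metric.ball_subset_ball hn').trans hhalf)

end ConvexGeometry

/-! ### Boundedness and continuity of the eigenvalues -/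

section Main

variable {N : ℕ} {D : Set (EuclideanSpace ℝ (Fin N))} {m : ℝ}
  {a : EuclideanSpace ℝ (Fin N) → Matrix (Fin N) (Fin N) ℝ}

lemma exists_coeff_bound (hD : IsCompact D) (ha : ∀ i j, ContinuousOn (fun x => a x i j) D) :
    ∃ K : ℝ, 0 ≤ K ∧ ∀ x ∈ D, ∀ i j, |a x i j| ≤ K := by
  choose K hK using fun i j => hD.exists_bound_of_continuousOn (ha i j)
  refine ⟨∑ i, ∑ j, |K i j|, by positivity, fun x hx i j => (hK i j x hx).trans ?_⟩
  calc K i j ≤ |K i j| := le_abs_self _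
    _ ≤ ∑ j, |K i j| := Finset.single_le_sum (f := fun j => |K i j|)
        (fun _ _ => abs_nonneg _) (Finset.mem_univ j)
    _ ≤ ∑ i, ∑ j, |K i j| := Finset.single_le_sum (f := fun i => ∑ j, |K i j|)
        (fun _ _ => Finset.sum_nonneg fun _ _ => abs_nonneg _) (Finset.mem_univ i)

lemma isAdmissible_of_continuousOn (hD : IsCompact D)
    (ha : ∀ i j, ContinuousOn (fun x => a x i j) D) (hsymm : ∀ x ∈ D, (a x).IsSymm)
    (hell : UniformlyEllipticOn a D) {Ω : Set (EuclideanSpace ℝ (Fin N))} (hΩ : Ω ⊆ D) :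
    IsAdmissible a Ω where
  meas i j := ((ha i j).aestronglyMeasurable hD.measurableSet).mono_measure
    (Measure.restrict_mono hΩ le_rfl)
  bdd := by
    obtain ⟨K, -, hK⟩ := exists_coeff_bound hD ha
    exact ⟨K, fun x hx => hK x (hΩ hx)⟩
  symm x hx := hsymm x (hΩ hx)
  elliptic := by
    obtain ⟨ν, hν, h⟩ := hell
    exact ⟨ν, hν, fun x hx => h x (hΩ hx)⟩

lemma sum_one_apply_mul (ξ : EuclideanSpace ℝ (Fin N)) :
    ∑ i, ∑ j, (1 : Matrix (Fin N) (Fin N) ℝ) i j * ξ j * ξ i = ‖ξ‖ ^ 2 := by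
  rw [EuclideanSpace.norm_sq_eq]
  simp [Matrix.one_apply, sq]

lemma isAdmissible_one (Ω : Set (EuclideanSpace ℝ (Fin N))) :
    IsAdmissible (fun _ => (1 : Matrix (Fin N) (Fin N) ℝ)) Ω where
  meas _ _ := aestronglyMeasurable_const
  bdd := ⟨1, fun _ _ i j => by rw [Matrix.one_apply]; split_ifs <;> simp⟩
  symm _ _ := Matrix.isSymm_one
  elliptic := ⟨1, one_pos, fun _ _ ξ => by
    rw [one_mul, ← sum_one_apply_mul]
    exact (Finset.sum_congr rfl fun i _ => Finset.sum_congr rfl fun j _ => by ring).le⟩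

/-- The Dirichlet eigenvalues are bounded on `C_m(D)`. -/
theorem exists_dirichletEigenvalue_mem_Icc (hN : 1 ≤ N) (hD : IsCompact D) (hm : 0 < m)
    (ha : ∀ i j, ContinuousOn (fun x => a x i j) D) (hsymm : ∀ x ∈ D, (a x).IsSymm)
    (hell : UniformlyEllipticOn a D) {k : ℕ} (hk : 1 ≤ k) :
    ∃ M : ℝ, ∀ Ω ∈ convexClass D m, dirichletEigenvalue a k Ω ∈ Set.Icc (-M) M := by
  obtain ⟨r, hr, hball⟩ := exists_forall_ball_subset hD hm
  obtain ⟨K, hK0, hK⟩ := exists_coeff_bound hD ha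
  set lam := dirichletEigenvalue (fun _ => (1 : Matrix (Fin N) (Fin N) ℝ)) k
    (Metric.ball (0 : EuclideanSpace ℝ (Fin N)) r)
  refine ⟨N * N * K * lam, fun Ω hΩ => ?_⟩
  obtain ⟨x₀, hx₀⟩ := hball Ω hΩ
  have hadm := isAdmissible_of_continuousOn hD ha hsymm hell hΩ.1
  have hmap : ∀ x ∈ Metric.ball (0 : EuclideanSpace ℝ (Fin N)) r, x₀ + (1 : ℝ) • x ∈ Ω := by
    intro x hx
    exact hx₀ (by simpa using hx)
  have h1 := dirichletEigenvalue_le_of_homothety (isAdmissible_one _) hadm hN Metric.isOpen_ball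
    hΩ.2.1 ⟨0, Metric.mem_ball_self hr⟩ Metric.isBounded_ball (hD.isBounded.subset hΩ.1) one_pos
    hmap (C := N * N * K) (by positivity) (fun x hx ξ => by
      rw [sum_one_apply_mul, sq]
      exact (le_abs_self _).trans (abs_sum_le (hK _ (hΩ.1 (hmap x hx))) ξ ξ)) hk
  have h0 := (hadm.isLeast_dirichletEigenvalue hN hΩ.2.1 (nonempty_of_mem_convexClass hm hΩ)
    (hD.isBounded.subset hΩ.1) hk).1
  rw [inv_one, one_pow, one_mul] at h1
  exact ⟨by linarith, h1⟩

/-- Close points have close quadratic forms. -/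
lemma exists_forall_sum_le_mul (hD : IsCompact D)
    (ha : ∀ i j, ContinuousOn (fun x => a x i j) D) (hell : UniformlyEllipticOn a D)
    {q : ℝ} (hq : 1 < q) : ∃ η : ℝ, 0 < η ∧ ∀ x ∈ D, ∀ y ∈ D, dist x y < η →
      ∀ ξ : EuclideanSpace ℝ (Fin N),
        ∑ i, ∑ j, a y i j * ξ j * ξ i ≤ q * ∑ i, ∑ j, a x i j * ξ j * ξ i := by
  obtain ⟨ν, hν, hell⟩ := hell
  -- An entrywise error `δ` changes the form by at most `N * N * δ * ‖ξ‖ ^ 2`, which ellipticity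
  -- absorbs into `q - 1` times the form.
  set δ : ℝ := ν * (q - 1) / (N * N + 1) with hδ
  have hδ0 : 0 < δ := div_pos (mul_pos hν (by linarith)) (by positivity)
  choose η hη0 hη using fun i j =>
    Metric.uniformContinuousOn_iff.1 (hD.uniformContinuousOn_of_continuous (ha i j)) δ hδ0
  have hev : ∀ᶠ s in 𝓝[>] (0 : ℝ), ∀ i j, s < η i j :=
    eventually_all.2 fun i => eventually_all.2 fun j =>
      nhdsWithin_le_nhds (eventually_lt_nhds (hη0 i j))
  obtain ⟨s, hs, hs0⟩ := (hev.and self_mem_nhdsWithin).exists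
  refine ⟨s, hs0, fun x hx y hy hxy ξ => ?_⟩
  have h1 : ∀ i j, |(a y - a x) i j| ≤ δ := fun i j => by
    have := hη i j x hx y hy (hxy.trans (hs i j))
    rw [dist_comm, Real.dist_eq] at this
    exact this.le
  have h2 := (le_abs_self _).trans (abs_sum_le h1 ξ ξ)
  have h3 : ∑ i, ∑ j, (a y - a x) i j * ξ j * ξ i =
      ∑ i, ∑ j, a y i j * ξ j * ξ i - ∑ i, ∑ j, a x i j * ξ j * ξ i := by
    simp only [Matrix.sub_apply, sub_mul, Finset.sum_sub_distrib]
  have h4 : ν * ‖ξ‖ ^ 2 ≤ ∑ i, ∑ j, a x i j * ξ j * ξ i := by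
    refine (hell x hx ξ).trans_eq ?_
    exact Finset.sum_congr rfl fun i _ => Finset.sum_congr rfl fun j _ => by ring
  have h5 : N * N * δ ≤ (q - 1) * ν := by
    rw [hδ, mul_div_assoc', div_le_iff₀ (by positivity)]
    nlinarith [mul_pos hν (sub_pos.2 hq)]
  have h6 : N * N * δ * (‖ξ‖ * ‖ξ‖) ≤ (q - 1) * (ν * ‖ξ‖ ^ 2) := by
    nlinarith [mul_le_mul_of_nonneg_right h5 (sq_nonneg ‖ξ‖)]
  have h7 := mul_le_mul_of_nonneg_left h4 (sub_nonneg.2 hq.le)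
  rw [h3] at h2
  linarith

/-- Comparison of the Dirichlet eigenvalues on sets of `C_m(D)`, when a contraction of small
amplitude maps one into the other. -/
lemma dirichletEigenvalue_le_of_contraction (hN : 1 ≤ N) (hD : IsCompact D) (hm : 0 < m)
    (ha : ∀ i j, ContinuousOn (fun x => a x i j) D) (hsymm : ∀ x ∈ D, (a x).IsSymm)
    (hell : UniformlyEllipticOn a D) {k : ℕ} (hk : 1 ≤ k) {R : ℝ}
    (hR : D ⊆ Metric.closedBall 0 R) {q η t : ℝ} (hq : 1 < q)
    (hη : ∀ x ∈ D, ∀ y ∈ D, dist x y < η → ∀ ξ : EuclideanSpace ℝ (Fin N),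
        ∑ i, ∑ j, a y i j * ξ j * ξ i ≤ q * ∑ i, ∑ j, a x i j * ξ j * ξ i)
    (ht0 : 0 < t) (ht1 : t < 1) (htη : (1 - t) * (2 * R) < η) (htq : t⁻¹ ^ 2 ≤ q)
    {Ω Ω' : Set (EuclideanSpace ℝ (Fin N))} (hΩ : Ω ∈ convexClass D m)
    (hΩ' : Ω' ∈ convexClass D m) {x₀ : EuclideanSpace ℝ (Fin N)} (hx₀ : x₀ ∈ D)
    (hmap : ∀ x ∈ Ω, (1 - t) • x₀ + t • x ∈ Ω') :
    dirichletEigenvalue a k Ω' ≤ q * q * dirichletEigenvalue a k Ω := by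
  have hadm := isAdmissible_of_continuousOn hD ha hsymm hell hΩ.1
  have hne := nonempty_of_mem_convexClass hm hΩ
  have hb := hD.isBounded.subset hΩ.1
  have h0 := (hadm.isLeast_dirichletEigenvalue hN hΩ.2.1 hne hb hk).1
  refine (dirichletEigenvalue_le_of_homothety hadm
    (isAdmissible_of_continuousOn hD ha hsymm hell hΩ'.1) hN hΩ.2.1 hΩ'.2.1 hne hb
    (hD.isBounded.subset hΩ'.1) ht0 hmap (C := q) (by linarith) (fun x hx ξ => ?_) hk).trans ?_
  · refine hη x (hΩ.1 hx) _ (hΩ'.1 (hmap x hx)) ?_ ξ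
    have h1 : x - ((1 - t) • x₀ + t • x) = (1 - t) • (x - x₀) := by
      rw [smul_sub, sub_smul, sub_smul, one_smul, one_smul]; abel
    rw [dist_eq_norm, h1, norm_smul, Real.norm_of_nonneg (by linarith)]
    have h2 := mem_closedBall_zero_iff.1 (hR (hΩ.1 hx))
    have h3 := mem_closedBall_zero_iff.1 (hR hx₀)
    refine (mul_le_mul_of_nonneg_left ((norm_sub_le x x₀).trans ?_) (by linarith)).trans_lt htη
    linarith
  · gcongr

/-- Under uniform convergence the Dirichlet eigenvalues become arbitrarily close, in ratio. -/
theorem eventually_dirichletEigenvalue_le (hN : 1 ≤ N) (hD : IsCompact D) (hm : 0 < m)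
    (ha : ∀ i j, ContinuousOn (fun x => a x i j) D) (hsymm : ∀ x ∈ D, (a x).IsSymm)
    (hell : UniformlyEllipticOn a D) {k : ℕ} (hk : 1 ≤ k)
    {Ωs : ℕ → Set (EuclideanSpace ℝ (Fin N))} {Ω : Set (EuclideanSpace ℝ (Fin N))}
    (hΩs : ∀ n, Ωs n ∈ convexClass D m) (hΩ : Ω ∈ convexClass D m)
    (hlim : UniformlyConverges Ωs Ω) {q : ℝ} (hq : 1 < q) :
    ∀ᶠ n in atTop, dirichletEigenvalue a k Ω ≤ q * q * dirichletEigenvalue a k (Ωs n) ∧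
      dirichletEigenvalue a k (Ωs n) ≤ q * q * dirichletEigenvalue a k Ω := by
  obtain ⟨R, hR⟩ := hD.isBounded.subset_closedBall 0
  obtain ⟨η, hη0, hη⟩ := exists_forall_sum_le_mul hD ha hell hq
  obtain ⟨x₀, hx₀⟩ := nonempty_of_mem_convexClass hm hΩ
  obtain ⟨r, hr, hball⟩ := Metric.isOpen_iff.1 hΩ.2.1 x₀ hx₀
  obtain ⟨t, ⟨ht0, htη, htq⟩, ht1⟩ : ∃ t : ℝ, (0 < t ∧ (1 - t) * (2 * R) < η ∧ t⁻¹ ^ 2 ≤ q) ∧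
      t < 1 := by
    have h1 : ∀ᶠ t in 𝓝 (1 : ℝ), 0 < t := eventually_gt_nhds one_pos
    have h2 : ∀ᶠ t in 𝓝 (1 : ℝ), (1 - t) * (2 * R) < η := by
      have : Continuous fun t : ℝ => (1 - t) * (2 * R) := by fun_prop
      exact (this.tendsto 1).eventually_lt_const (by simpa using hη0)
    have h3 : ∀ᶠ t in 𝓝 (1 : ℝ), t⁻¹ ^ 2 ≤ q := by
      have : Tendsto (fun t : ℝ => t⁻¹ ^ 2) (𝓝 1) (𝓝 (1⁻¹ ^ 2)) :=
        (tendsto_inv₀ one_ne_zero).pow 2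
      exact this.eventually_le_const (by simpa using hq)
    exact (((h1.and (h2.and h3)).filter_mono nhdsWithin_le_nhds).and
      (self_mem_nhdsWithin (s := Set.Iio (1 : ℝ)))).exists
  -- The first bound keeps the ball of radius `r / 2` inside `Ωs n`; the second lets the contraction
  -- of ratio `t` absorb an error `ε` in both directions.
  set ε : ℝ := min (r / 2) ((1 - t) * (r / 2)) with hε
  have hε0 : 0 < ε := lt_min (by positivity) (mul_pos (by linarith) (by positivity))
  have hεt : t * ε ≤ (1 - t) * (r / 2) := by
    have h1 : ε ≤ (1 - t) * (r / 2) := min_le_right _ _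
    nlinarith
  filter_upwards [hlim ε hε0] with n hn
  have hhalf := ball_half_subset_of_subset_add_ball (hΩs n).2.1 (hΩs n).2.2.1 hr
    (min_le_left _ _) (hball.trans hn.2)
  constructor
  · exact dirichletEigenvalue_le_of_contraction hN hD hm ha hsymm hell hk hR hq hη ht0 ht1 htη htq
      (hΩs n) hΩ (hΩ.1 hx₀) fun x hx => homothety_mem_of_subset_add_ball hΩ.2.2.1
        ((Metric.ball_subset_ball (by linarith)).trans hball) ht0 ht1 hεt (hn.1 hx)
  · exact dirichletEigenvalue_le_of_contraction hN hD hm ha hsymm hell hk hR hq hη ht0 ht1 htη htq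
      hΩ (hΩs n) (hΩ.1 hx₀) fun x hx => homothety_mem_of_subset_add_ball (hΩs n).2.2.1
        hhalf ht0 ht1 hεt (hn.2 hx)

/-- Letting `q` decrease to `1` turns closeness in ratio into convergence; no sign of `l` or `u` is
required, so a zero limit is covered. -/
lemma tendsto_of_forall_eventually_le_mul {u : ℕ → ℝ} {l : ℝ}
    (h : ∀ q : ℝ, 1 < q → ∀ᶠ n in atTop, l ≤ q * q * u n ∧ u n ≤ q * q * l) :
    Tendsto u atTop (𝓝 l) := by
  refine tendsto_order.2 ⟨fun b hb => ?_, fun b hb => ?_⟩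
  · have h1 : ∀ᶠ q in 𝓝[>] (1 : ℝ), q * q * b < l := by
      have : Continuous fun q : ℝ => q * q * b := by fun_prop
      exact nhdsWithin_le_nhds ((this.tendsto 1).eventually_lt_const (by simpa using hb))
    obtain ⟨q, hq, hq1⟩ := (h1.and self_mem_nhdsWithin).exists
    have hq1 : 1 < q := hq1
    filter_upwards [h q hq1] with n hn
    exact lt_of_mul_lt_mul_left (hq.trans_le hn.1) (by positivity)
  · have h1 : ∀ᶠ q in 𝓝[>] (1 : ℝ), q * q * l < b := by
      have : Continuous fun q : ℝ => q * q * l := by fun_prop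
      exact nhdsWithin_le_nhds ((this.tendsto 1).eventually_lt_const (by simpa using hb))
    obtain ⟨q, hq, hq1⟩ := (h1.and self_mem_nhdsWithin).exists
    filter_upwards [h q hq1] with n hn
    exact hn.2.trans_lt hq

end Main

end

theorem mainTheorem5 {N : ℕ} (hN : 1 ≤ N)
    (D : Set (EuclideanSpace ℝ (Fin N))) (hD : IsCompact D) (m : ℝ) (hm : 0 < m)
    (a : EuclideanSpace ℝ (Fin N) → Matrix (Fin N) (Fin N) ℝ)
    (ha_cont : ∀ i j, ContinuousOn (fun x => a x i j) D)
    (ha_symm : ∀ x ∈ D, (a x).IsSymm)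
    (ha_ell : UniformlyEllipticOn a D)
    (k : ℕ) (hk : 1 ≤ k) :
    -- the `k`-th eigenvalue exists for every domain of the class
    (∀ Ω ∈ convexClass D m,
      IsLeast (eigenvalueBounds a Ω k) (dirichletEigenvalue a k Ω)) ∧
    -- boundedness
    (∃ M : ℝ, ∀ Ω ∈ convexClass D m, dirichletEigenvalue a k Ω ∈ Set.Icc (-M) M) ∧
    -- continuity
    (∀ (Ωs : ℕ → Set (EuclideanSpace ℝ (Fin N))) (Ω : Set (EuclideanSpace ℝ (Fin N))),
      (∀ n, Ωs n ∈ convexClass D m) → Ω ∈ convexClass D m → UniformlyConverges Ωs Ω →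
      Tendsto (fun n => dirichletEigenvalue a k (Ωs n)) atTop
        (𝓝 (dirichletEigenvalue a k Ω))) := by
  refine ⟨fun Ω hΩ => ?_, ?_, fun Ωs Ω hΩs hΩ hlim => ?_⟩
  · exact ((isAdmissible_of_continuousOn hD ha_cont ha_symm ha_ell hΩ.1).isLeast_dirichletEigenvalue
      hN hΩ.2.1 (nonempty_of_mem_convexClass hm hΩ) (hD.isBounded.subset hΩ.1) hk).2.1
  · exact exists_dirichletEigenvalue_mem_Icc hN hD hm ha_cont ha_symm ha_ell hk
  · exact tendsto_of_forall_eventually_le_mul fun q hq =>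
      eventually_dirichletEigenvalue_le hN hD hm ha_cont ha_symm ha_ell hk hΩs hΩ hlim hq
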